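/- **Notation.** Let $\Omega=\{x\in\mathbb C: |x(1-x^2)|>\frac{2}{3\sqrt3}\}$, a connected open set. Let $\mathsf H_n=\sum_{j=1}^n\frac1j$ and $c_k(x)=\frac{\binom{2k}{k}}{\binom{3k}{k}\binom{6k}{3k}}\left[\frac{2^2}{x(1-x^2)}\right]^{2k}$. All logarithms and square roots are principal unless stated otherwise, $\tanh^{-1}z=\frac12[\log(1+z)-\log(1-z)]$, and $\mathrm{Li}_2(z)=-\int_0^1\frac{\log(1-zt)}{t}\,dt$. Put $s(x)=\sqrt{3x^2-4}$ and $\sigma_{\ell,m}(x)=\frac{(-1)^\ell x+i(-1)^m s(x)}{2}$ for $\ell,m\in\{0,1\}$, and define $$\mathfrak L(x)=2\left[\mathrm{Li}_2\left(-\tfrac1x\right)-\mathrm{Li}_2\left(\tfrac1x\right)\right]-\sum_{\ell,m\in\{0,1\}}(-1)^\ell\,\mathrm{Li}_2\left(\tfrac1{\sigma_{\ell,m}(x)}\right),\qquad \mathfrak M(x)=\sum_{\ell,m\in\{0,1\}}(-1)^m\,\mathrm{Li}_2\left(\tfrac1{\sigma_{\ell,m}(x)}\right),$$ $$B(x)=\mathrm{Li}_2\left(\tfrac{1-x}{1+x}\right)-\mathrm{Li}_2\left(\tfrac{1+x}{1-x}\right)+\log^2\left(1+\tfrac1x\right)-\log^2\left(1-\tfrac1x\right),$$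 $$\mathfrak l(x)=2B(x)+\sum_{\ell,m\in\{0,1\}}(-1)^\ell\left[\mathrm{Li}_2\left(\tfrac{1-\sigma_{\ell,m}(x)}{1+\sigma_{\ell,m}(x)}\right)+\log^2\left(1+\tfrac1{\sigma_{\ell,m}(x)}\right)\right],$$ $$\mathfrak m(x)=\sum_{\ell,m\in\{0,1\}}(-1)^m\left[\mathrm{Li}_2\left(\tfrac{1-\sigma_{\ell,m}(x)}{1+\sigma_{\ell,m}(x)}\right)+\log^2\left(1+\tfrac1{\sigma_{\ell,m}(x)}\right)\right].$$ **Proposition.** The functions $\mathfrak L$, $\mathfrak M/s$, $\mathfrak l$, $\mathfrak m/s$ and $x\mapsto\tanh^{-1}\frac1x$ are holomorphic on $\Omega$. There is a function $\Lambda$ such that $\Lambda/s$ is holomorphic on $\Omega$, $e^{\Lambda(x)}=\frac{x^2-2+is(x)}{x^2-2-is(x)}$ for $x\in\Omega$, and $\Lambda(x)$ equals the principal value $\log\frac{x^2-2+is(x)}{x^2-2-is(x)}$ whenever $|x|\ge\sqrt2$. With this (on $\Omega$, unique) $\Lambda$, the following series converge and have the stated sums for every $x\in\Omega$, where $s=s(x)$,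 $\Lambda=\Lambda(x)$, $\mathfrak L=\mathfrak L(x)$, and so on, and $T=\tanh^{-1}\frac1x$. (A) $\sum_{k\ge1}\frac{a_k}{k}c_k(x)$ equals 1. for $a_k=1$: $\frac1{1-3x^2}\left[6xT+\frac{i(3x^2-2)}{s}\Lambda\right]$; 2. for $a_k=-\mathsf H_k+2\mathsf H_{2k}+\mathsf H_{3k}-2\mathsf H_{6k}$: $\frac{2}{1-3x^2}\left[x\mathfrak L+\frac{i(3x^2-2)\mathfrak M}{s}\right]$; 3. for $a_k=\mathsf H_k-\mathsf H_{2k}-\frac1{2k}+2\log2$: $\frac{1}{1-3x^2}\left[x\mathfrak l-\frac{i(3x^2-2)\mathfrak m}{s}\right]$; 4. for $a_k=\frac1k$: $-6T^2-\frac12\Lambda^2$. (B) $\sum_{k\ge0}\frac{a_k}{6k+1}c_k(x)$ equals 1. for $a_k=1$: $\frac{3x(1-x^2)}{2(1-3x^2)}\left[T-\frac{ix}{2s}\Lambda\right]$; 2. for $a_k=-\mathsf H_k+2\mathsf H_{2k}+\mathsf H_{3k}-2\mathsf H_{6k+1}$: $\frac{x(1-x^2)}{2(1-3x^2)}\left[\mathfrak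 L-\frac{3ix\mathfrak M}{s}\right]$; 3. for $a_k=\mathsf H_k-\mathsf H_{2k}+2\log2$: $\frac{x(1-x^2)}{4(1-3x^2)}\left[\mathfrak l+\frac{3ix\mathfrak m}{s}\right]$. (C) $\sum_{k\ge0}\frac{a_k}{6k+5}c_k(x)$ equals 1. for $a_k=1$: $\frac{3x(1-x^2)}{2(3x^2-1)}\left[(9x^4-9x^2+1)T+\frac{ix(9x^4-15x^2+5)}{2s}\Lambda\right]$; 2. for $a_k=\mathsf H_k-\mathsf H_{2k}+2\log2$: $\frac{x(1-x^2)}{4(3x^2-1)}\left[(9x^4-9x^2+1)\mathfrak l-\frac{3ix(9x^4-15x^2+5)\mathfrak m}{s}\right]-\frac{9x(1-x^2)}{4}\left[(3x^2-2)T+\frac{ixs}{2}\Lambda\right]$. (D) $\sum_{k\ge1}\frac{a_k}{2k-1}c_k(x)$ equals 1. for $a_k=1$: $\frac{1}{2(1-x^2)(1-3x^2)}\left[\frac{3x^4-3x^2+2}{x}T+\frac{ix^2(3x^2-5)}{2s}\Lambda\right]$; 2. for $a_k=-\mathsf H_k+2\mathsf H_{2k}+\mathsf H_{3k}-2\mathsf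 H_{6k}-\frac2{2k-1}$: $\frac1{x(1-x^2)}\left[\mathrm{Li}_2\left(-\frac1x\right)-\mathrm{Li}_2\left(\frac1x\right)\right]+\frac{x}{2(1-x^2)(1-3x^2)}\left[(1+x^2)\mathfrak L+\frac{ix(3x^2-5)\mathfrak M}{s}\right]$; 3. for $a_k=\mathsf H_k-\mathsf H_{2k}+\frac2{2k-1}+2\log2$: $\frac{1}{2x(1-x^2)}B(x)+\frac{x}{4(1-x^2)(1-3x^2)}\left[(1+x^2)\mathfrak l-\frac{ix(3x^2-5)\mathfrak m}{s}\right]$; 4. for $a_k=\frac1{2k-1}$: $-\frac{3}{2x(1-x^2)}\left[\mathrm{Li}_2\left(-\frac1x\right)-\mathrm{Li}_2\left(\frac1x\right)\right]+\frac{\mathfrak L}{2x(1-x^2)}+\frac{1}{4x(1-x^2)}\left[(3x^2-2)T+\frac{ixs}{2}\Lambda\right]$. -/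

import Mathlib

noncomputable section

namespace BinomialSeries

/-- The dilogarithm `Li₂(z) = -∫₀¹ log(1 - z t) / t dt`, the principal branch on `ℂ ∖ [1, ∞)`. -/
def Li2 (z : ℂ) : ℂ :=
  -∫ t in (0 : ℝ)..1, Complex.log (1 - z * (t : ℂ)) / (t : ℂ)

/-- The principal branch of the inverse hyperbolic tangent. -/
def arctanh (z : ℂ) : ℂ :=
  (Complex.log (1 + z) - Complex.log (1 - z)) / 2

/-- The principal square root of `3 x² - 4`. -/
def rt (x : ℂ) : ℂ := (3 * x ^ 2 - 4) ^ (1 / 2 : ℂ)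

/-- `σ_{ℓ,m}(x) = ((-1)^ℓ x + i (-1)^m √(3x²-4)) / 2`, used for `ℓ, m ∈ {0, 1}`. -/
def sigma (l m : ℕ) (x : ℂ) : ℂ :=
  ((-1) ^ l * x + Complex.I * (-1) ^ m * rt x) / 2

/-- The function `𝔏`. -/
def frakL (x : ℂ) : ℂ :=
  2 * (Li2 (-1 / x) - Li2 (1 / x))
    - ∑ l ∈ Finset.range 2, ∑ m ∈ Finset.range 2, (-1) ^ l * Li2 (1 / sigma l m x)

/-- The function `𝔐`. -/
def frakM (x : ℂ) : ℂ :=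
  ∑ l ∈ Finset.range 2, ∑ m ∈ Finset.range 2, (-1) ^ m * Li2 (1 / sigma l m x)

/-- `Li₂((1-x)/(1+x)) - Li₂((1+x)/(1-x)) + log²(1+1/x) - log²(1-1/x)`. -/
def beta (x : ℂ) : ℂ :=
  Li2 ((1 - x) / (1 + x)) - Li2 ((1 + x) / (1 - x))
    + Complex.log (1 + 1 / x) ^ 2 - Complex.log (1 - 1 / x) ^ 2

/-- The function `𝔩`. -/
def frakl (x : ℂ) : ℂ :=
  2 * beta x
    + ∑ l ∈ Finset.range 2, ∑ m ∈ Finset.range 2,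
        (-1) ^ l * (Li2 ((1 - sigma l m x) / (1 + sigma l m x))
          + Complex.log (1 + 1 / sigma l m x) ^ 2)

/-- The function `𝔪`. -/
def frakm (x : ℂ) : ℂ :=
  ∑ l ∈ Finset.range 2, ∑ m ∈ Finset.range 2,
    (-1) ^ m * (Li2 ((1 - sigma l m x) / (1 + sigma l m x))
      + Complex.log (1 + 1 / sigma l m x) ^ 2)

/-- The open region `|x (1 - x²)| > 2 / (3√3)`. -/
def region : Set ℂ := {x | 2 / (3 * Real.sqrt 3) < ‖x * (1 - x ^ 2)‖}

/-- The quotient `(x² - 2 + i√(3x²-4)) / (x² - 2 - i√(3x²-4))`. -/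
def quot (x : ℂ) : ℂ :=
  (x ^ 2 - 2 + Complex.I * rt x) / (x ^ 2 - 2 - Complex.I * rt x)

/-- The harmonic number `H_n` as a complex number. -/
def H (n : ℕ) : ℂ := ((harmonic n : ℚ) : ℂ)

/-- The summand `a_k C(2k,k) / (d_k C(3k,k) C(6k,3k)) · [2² / (x(1-x²))]^{2k}`. -/
def summand (a d : ℕ → ℂ) (x : ℂ) (k : ℕ) : ℂ :=
  a k * ((2 * k).choose k : ℂ) / (d k * ((3 * k).choose k : ℂ) * ((6 * k).choose (3 * k) : ℂ))
    * (2 ^ 2 / (x * (1 - x ^ 2))) ^ (2 * k)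

/-- `S` is the sum of the (absolutely convergent) series `∑_{k ≥ k₀} a_k C(2k,k) /
(d_k C(3k,k) C(6k,3k)) · [2² / (x(1-x²))]^{2k}`. -/
def SeriesEq (k₀ : ℕ) (a d : ℕ → ℂ) (x S : ℂ) : Prop :=
  HasSum (fun j : ℕ => summand a d x (j + k₀)) S

end BinomialSeries

end

open BinomialSeries

open BinomialSeries

namespace BinomialSeries

open Set Filter Topology Interval MeasureTheory
open Complex (slitPlane)
open scoped Nat

/-! Put c = x(1 - x²) and p(y) = y(1 - y²). For a weight W on [0,1] the moments ∫ W(y)(1 - y²)^m y^n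
dy satisfy a recurrence obtained by integrating the derivative of (1 - y²)^(m+1) y^(n+1) against W.
For W = 1 they are Beta values, and at m = n = 2k they equal `coeff k / (6k+1)`. For W = log y and W
= log((1 - y²)/y²) they equal the same values times combinations of harmonic numbers, which produce
the coefficients a_k. Other denominators come from even polynomial numerators Q(y) of degree at most
four.

On [0,1] the maximum of p² is 4/27, so `region` is exactly the condition under which the geometric
series in (p/c)² converges uniformly. Each series is then ∫ W Q / (c² - p²), up to a factor c²
(`hasSum_moment`). The denominator is the product of w² - y² over w = x, a, b, where a, b are `rootA
x`, `rootB x`: a + b = x, ab = x² - 1 and a(1 - a²) = b(1 - b²) = -c. Partial fractions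
(`partialFraction`, `genInt_eq`) reduce everything to the integrals `kernelInt W (1/w)`. These are 2
tanh⁻¹(1/w) for W = 1, a difference of dilogarithms for W = log y, and `beta w` for W = log((1 -
y²)/y²). The three points 1/w avoid the cuts because a real w in [-1,1] has |w(1 - w²)|² ≤ 4/27,
while all three w share the value |c|.

Taking Q = p' makes the integral with W = 1 vanish, which gives tanh⁻¹(1/a) + tanh⁻¹(1/b) =
tanh⁻¹(1/x). The remaining difference of the two terms is, up to the factor 2, the function Λ
(`contLog`). The series with 1/k² uses W = tanh⁻¹ y and the logarithmic derivative of c² - p². The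
other two series that are not a single such integral, `seriesEq_C2` and `seriesEq_D4`, are corrected
by elementary series already summed.

Holomorphy holds although `rt` jumps across its cut, because every expression in question is
invariant under exchanging a and b together with the sign of `rt`. That Λ is the principal logarithm
for |x| ≥ √2 follows by continuity along rays: Λ is small near infinity, and |Im Λ| can reach π only
where x² = 2. -/

/-! ### Differentiation under the integral sign -/

/-- Differentiation of `∫₀¹ ω(t) K(z,t) dt` in `z` for an integrable weight and a smooth kernel. -/
theorem hasDerivAt_integral_mul_kernel {U : Set ℂ} (hU : IsOpen U) {ω : ℝ → ℂ}
    (hω : IntervalIntegrable ω volume 0 1) {K K' : ℂ → ℝ → ℂ}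
    (hK : ∀ z ∈ U, ContinuousOn (K z) (Icc 0 1))
    (hK' : ContinuousOn (fun p : ℂ × ℝ => K' p.1 p.2) (U ×ˢ Icc 0 1))
    (hd : ∀ z ∈ U, ∀ t ∈ Icc (0 : ℝ) 1, HasDerivAt (fun z => K z t) (K' z t) z)
    {z : ℂ} (hz : z ∈ U) :
    HasDerivAt (fun z => ∫ t in (0 : ℝ)..1, ω t * K z t) (∫ t in (0 : ℝ)..1, ω t * K' z t) z := by
  have hu : uIcc (0 : ℝ) 1 = Icc 0 1 := uIcc_of_le zero_le_one
  obtain ⟨ε, hε, hball⟩ := Metric.nhds_basis_closedBall.mem_iff.1 (hU.mem_nhds hz)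
  have hcomp : IsCompact (Metric.closedBall z ε ×ˢ Icc (0 : ℝ) 1) :=
    (isCompact_closedBall z ε).prod isCompact_Icc
  -- The kernel derivative is bounded on a compact neighbourhood times [0,1], so |ω| times this
  -- bound dominates, even if ω is unbounded.
  obtain ⟨C, hC⟩ := hcomp.exists_bound_of_continuousOn
    (hK'.mono (prod_mono hball Subset.rfl))
  have hint : ∀ w ∈ U, IntervalIntegrable (fun t => ω t * K w t) volume 0 1 := fun w hw =>
    hω.mul_continuousOn (by rw [hu]; exact hK w hw)
  have hint' : IntervalIntegrable (fun t => ω t * K' z t) volume 0 1 :=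
    hω.mul_continuousOn (by
      rw [hu]
      exact hK'.comp (f := fun t : ℝ => (z, t)) (by fun_prop) (fun t ht => ⟨hz, ht⟩))
  have hsub : Ι (0 : ℝ) 1 ⊆ Icc 0 1 := by
    rw [uIoc_of_le zero_le_one]; exact Ioc_subset_Icc_self
  refine (intervalIntegral.hasDerivAt_integral_of_dominated_loc_of_deriv_le
    (F := fun z t => ω t * K z t) (F' := fun z t => ω t * K' z t)
    (bound := fun t => ‖ω t‖ * C) (Metric.closedBall_mem_nhds z hε) ?_ (hint z hz) ?_ ?_ ?_ ?_).2
  · filter_upwards [hU.mem_nhds hz] with w hw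
    exact (hint w hw).def'.aestronglyMeasurable
  · exact hint'.def'.aestronglyMeasurable
  · refine Eventually.of_forall fun t ht w hw => ?_
    rw [norm_mul]
    gcongr
    exact hC (w, t) ⟨hw, hsub ht⟩
  · exact hω.norm.mul_const C
  · exact Eventually.of_forall fun t ht w hw => (hd w (hball hw) t (hsub ht)).const_mul _

/-! ### Logarithmic weights and integration by parts -/

/-- `log y`. -/
noncomputable def wlog (y : ℝ) : ℂ := (Real.log y : ℂ)

/-- `log (1 - y)`. -/
noncomputable def wlogSub (y : ℝ) : ℂ := (Real.log (1 - y) : ℂ)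

/-- `log (1 + y)`. -/
noncomputable def wlogAdd (y : ℝ) : ℂ := (Real.log (1 + y) : ℂ)

/-- `log ((1 - y²) / y²)`. -/
noncomputable def well (y : ℝ) : ℂ := wlogSub y + wlogAdd y - 2 * wlog y

/-- `tanh⁻¹ y`. -/
noncomputable def wath (y : ℝ) : ℂ := (wlogAdd y - wlogSub y) / 2

theorem intervalIntegrable_wlog : IntervalIntegrable wlog volume 0 1 :=
  have h := intervalIntegral.intervalIntegrable_log' (a := 0) (b := 1)
  ⟨h.1.ofReal, h.2.ofReal⟩

theorem intervalIntegrable_wlogSub : IntervalIntegrable wlogSub volume 0 1 := by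
  have h := ((intervalIntegral.intervalIntegrable_log' (a := 0) (b := 1)).comp_sub_left 1).symm
  simp only [sub_zero, sub_self] at h
  exact ⟨h.1.ofReal, h.2.ofReal⟩

theorem continuousOn_wlogAdd : ContinuousOn wlogAdd (Icc 0 1) := by
  refine Complex.continuous_ofReal.comp_continuousOn (ContinuousOn.log (by fun_prop) ?_)
  intro y hy
  linarith [hy.1]

theorem _root_.ContinuousOn.intervalIntegrable_zero_one {f : ℝ → ℂ}
    (hf : ContinuousOn f (Icc 0 1)) : IntervalIntegrable f volume 0 1 :=
  ContinuousOn.intervalIntegrable (by rwa [uIcc_of_le zero_le_one])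

theorem _root_.IntervalIntegrable.mul_continuousOn_zero_one {f g : ℝ → ℂ}
    (hf : IntervalIntegrable f volume 0 1) (hg : ContinuousOn g (Icc 0 1)) :
    IntervalIntegrable (fun y => f y * g y) volume 0 1 :=
  hf.mul_continuousOn (by rwa [uIcc_of_le zero_le_one])

theorem intervalIntegrable_wlogAdd : IntervalIntegrable wlogAdd volume 0 1 :=
  continuousOn_wlogAdd.intervalIntegrable_zero_one

theorem intervalIntegrable_well : IntervalIntegrable well volume 0 1 :=
  (intervalIntegrable_wlogSub.add intervalIntegrable_wlogAdd).sub
    (intervalIntegrable_wlog.const_mul 2)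

theorem intervalIntegrable_wath : IntervalIntegrable wath volume 0 1 :=
  (intervalIntegrable_wlogAdd.sub intervalIntegrable_wlogSub).div_const 2

/-- Integration by parts against a logarithmic weight, the boundary terms being explicit. -/
theorem integral_weight_mul_deriv {W W' : ℝ → ℂ} {G G' : ℂ → ℂ} {g : ℝ → ℂ}
    (hW : IntervalIntegrable W volume 0 1)
    (hWd : ∀ y ∈ Ioo (0 : ℝ) 1, HasDerivAt W (W' y) y)
    (hd : ∀ y ∈ Icc (0 : ℝ) 1, HasDerivAt G (G' y) y)
    (hG' : ContinuousOn (fun y : ℝ => G' y) (Icc 0 1))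
    (hc : ContinuousOn (fun y : ℝ => W y * G y) (Icc 0 1))
    (hg : ContinuousOn g (Icc 0 1))
    (hgW : ∀ y ∈ Ioo (0 : ℝ) 1, W' y * G y = g y) :
    ∫ y in (0 : ℝ)..1, W y * G' y = W 1 * G 1 - W 0 * G 0 - ∫ y in (0 : ℝ)..1, g y := by
  have hi1 := hW.mul_continuousOn_zero_one hG'
  have hi2 := hg.intervalIntegrable_zero_one
  have key := intervalIntegral.integral_eq_sub_of_hasDerivAt_of_le (zero_le_one' ℝ) hc
    (f' := fun y => W y * G' y + g y) (fun y hy => by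
      have h := (hWd y hy).mul (hd y (Ioo_subset_Icc_self hy)).comp_ofReal
      rw [hgW y hy, add_comm] at h
      exact h) (hi1.add hi2)
  rw [intervalIntegral.integral_add hi1 hi2] at key
  push_cast at key
  rw [← key]; ring

/-- The primitive must vanish at the singular endpoint of the weight; `hfac` says so and makes `W *
G` continuous there, since y log y is. Both boundary terms disappear: log 1 = 0, and `Real.log 0 =
0` by convention. -/
theorem integral_wlog_mul_deriv {G G' : ℂ → ℂ} {g : ℝ → ℂ}
    (hd : ∀ y ∈ Icc (0 : ℝ) 1, HasDerivAt G (G' y) y)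
    (hG' : ContinuousOn (fun y : ℝ => G' y) (Icc 0 1))
    (hg : ContinuousOn g (Icc 0 1))
    (hfac : ∀ y ∈ Icc (0 : ℝ) 1, G y = y * g y) :
    ∫ y in (0 : ℝ)..1, wlog y * G' y = -∫ y in (0 : ℝ)..1, g y := by
  rw [integral_weight_mul_deriv (W' := fun y => ((y⁻¹ : ℝ) : ℂ)) (g := g) intervalIntegrable_wlog
    (fun y hy => (Real.hasDerivAt_log hy.1.ne').ofReal_comp) hd hG' ?_ hg ?_]
  · simp [wlog]
  · have : ContinuousOn (fun y : ℝ => ((y * Real.log y : ℝ) : ℂ) * g y) (Icc 0 1) :=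
      ((Complex.continuous_ofReal.comp Real.continuous_mul_log).continuousOn).mul hg
    refine this.congr fun y hy => ?_
    simp only [wlog]
    rw [hfac y hy]; push_cast; ring
  · intro y hy
    have : (y : ℂ) ≠ 0 := by exact_mod_cast hy.1.ne'
    rw [hfac y (Ioo_subset_Icc_self hy)]; push_cast; field_simp

theorem integral_wlogSub_mul_deriv {G G' : ℂ → ℂ} {g : ℝ → ℂ}
    (hd : ∀ y ∈ Icc (0 : ℝ) 1, HasDerivAt G (G' y) y)
    (hG' : ContinuousOn (fun y : ℝ => G' y) (Icc 0 1))
    (hg : ContinuousOn g (Icc 0 1))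
    (hfac : ∀ y ∈ Icc (0 : ℝ) 1, G y = (1 - y) * g y) :
    ∫ y in (0 : ℝ)..1, wlogSub y * G' y = ∫ y in (0 : ℝ)..1, g y := by
  rw [integral_weight_mul_deriv (W' := fun y => ((-(1 - y)⁻¹ : ℝ) : ℂ)) (g := fun y => -g y)
    intervalIntegrable_wlogSub ?_ hd hG' ?_ hg.neg ?_]
  · simp [wlogSub, intervalIntegral.integral_neg]
  · intro y hy
    have h1 : HasDerivAt (fun y : ℝ => 1 - y) (-1) y := (hasDerivAt_id y).const_sub 1
    have := (h1.log (by linarith [hy.2])).ofReal_comp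
    convert! this using 1
    push_cast; rw [neg_div, one_div]
  · have : ContinuousOn (fun y : ℝ => (((1 - y) * Real.log (1 - y) : ℝ) : ℂ) * g y) (Icc 0 1) :=
      ((Complex.continuous_ofReal.comp
        (Real.continuous_mul_log.comp (by fun_prop : Continuous fun y : ℝ => 1 - y))).continuousOn).mul
        hg
    refine this.congr fun y hy => ?_
    simp only [wlogSub]
    rw [hfac y hy]; push_cast; ring
  · intro y hy
    have : (1 - y : ℂ) ≠ 0 := by exact_mod_cast (by linarith [hy.2] : 1 - y ≠ 0)
    rw [hfac y (Ioo_subset_Icc_self hy)]; push_cast; field_simp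

/-- Here the weight is log 2 at the right endpoint, so `h1` is what removes that boundary term. -/
theorem integral_wlogAdd_mul_deriv {G G' : ℂ → ℂ} {g : ℝ → ℂ}
    (hd : ∀ y ∈ Icc (0 : ℝ) 1, HasDerivAt G (G' y) y)
    (hG' : ContinuousOn (fun y : ℝ => G' y) (Icc 0 1))
    (hg : ContinuousOn g (Icc 0 1))
    (hfac : ∀ y ∈ Icc (0 : ℝ) 1, G y = (1 + y) * g y) (h1 : G 1 = 0) :
    ∫ y in (0 : ℝ)..1, wlogAdd y * G' y = -∫ y in (0 : ℝ)..1, g y := by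
  rw [integral_weight_mul_deriv (W' := fun y => (((1 + y)⁻¹ : ℝ) : ℂ)) (g := g)
    intervalIntegrable_wlogAdd ?_ hd hG' ?_ hg ?_]
  · simp [wlogAdd, h1]
  · intro y hy
    have h1 : HasDerivAt (fun y : ℝ => 1 + y) 1 y := (hasDerivAt_id y).const_add 1
    have := (h1.log (by linarith [hy.1])).ofReal_comp
    convert! this using 1
    push_cast; rw [one_div]
  · exact continuousOn_wlogAdd.mul fun y hy =>
      ((hd y hy).comp_ofReal).continuousAt.continuousWithinAt
  · intro y hy
    have : (1 + y : ℂ) ≠ 0 := by exact_mod_cast (by linarith [hy.1] : 1 + y ≠ 0)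
    rw [hfac y (Ioo_subset_Icc_self hy)]; push_cast; field_simp

/-- Integration by parts against `log ((1 - y²) / y²)`. -/
theorem integral_well_mul_deriv {G G' : ℂ → ℂ} {g : ℝ → ℂ}
    (hd : ∀ y ∈ Icc (0 : ℝ) 1, HasDerivAt G (G' y) y)
    (hG' : ContinuousOn (fun y : ℝ => G' y) (Icc 0 1))
    (hg : ContinuousOn g (Icc 0 1))
    (hfac : ∀ y ∈ Icc (0 : ℝ) 1, G y = y * (1 - y ^ 2) * g y) :
    ∫ y in (0 : ℝ)..1, well y * G' y = 2 * ∫ y in (0 : ℝ)..1, g y := by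
  have e0 := integral_wlog_mul_deriv (g := fun y => (1 - y ^ 2) * g y) hd hG'
    (ContinuousOn.mul (by fun_prop) hg) fun y hy => by rw [hfac y hy]; ring
  have e1 := integral_wlogSub_mul_deriv (g := fun y => y * (1 + y) * g y) hd hG'
    (ContinuousOn.mul (by fun_prop) hg) fun y hy => by rw [hfac y hy]; ring
  have e2 := integral_wlogAdd_mul_deriv (g := fun y => y * (1 - y) * g y) hd hG'
    (ContinuousOn.mul (by fun_prop) hg) (fun y hy => by rw [hfac y hy]; ring)
    (by have := hfac 1 (by simp); push_cast at this; rw [this]; ring)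
  have c0 := intervalIntegrable_wlog.mul_continuousOn_zero_one hG'
  have c1 := intervalIntegrable_wlogSub.mul_continuousOn_zero_one hG'
  have c2 := intervalIntegrable_wlogAdd.mul_continuousOn_zero_one hG'
  have hpoly : ∀ q : ℝ → ℂ, Continuous q → IntervalIntegrable (fun y => q y * g y) volume 0 1 :=
    fun q hq => (hq.continuousOn.mul hg).intervalIntegrable_zero_one
  have d0 := hpoly (fun y => 1 - y ^ 2) (by fun_prop)
  have d1 := hpoly (fun y => y * (1 + y)) (by fun_prop)
  have d2 := hpoly (fun y => y * (1 - y)) (by fun_prop)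
  calc ∫ y in (0 : ℝ)..1, well y * G' y
      = ∫ y in (0 : ℝ)..1, (wlogSub y * G' y + wlogAdd y * G' y - 2 * (wlog y * G' y)) := by
        congr 1; ext y; simp only [well]; ring
    _ = (∫ y in (0 : ℝ)..1, y * (1 + y) * g y) - (∫ y in (0 : ℝ)..1, y * (1 - y) * g y)
        + 2 * ∫ y in (0 : ℝ)..1, (1 - y ^ 2) * g y := by
        rw [intervalIntegral.integral_sub (c1.add c2) (c0.const_mul 2),
          intervalIntegral.integral_add c1 c2, intervalIntegral.integral_const_mul, e0, e1, e2]
        ring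
    -- y(1 + y) - y(1 - y) + 2(1 - y²) = 2.
    _ = 2 * ∫ y in (0 : ℝ)..1, g y := by
        rw [← intervalIntegral.integral_const_mul, ← intervalIntegral.integral_sub d1 d2,
          ← intervalIntegral.integral_add (d1.sub d2) (d0.const_mul 2),
          ← intervalIntegral.integral_const_mul]
        congr 1; ext y; ring

/-- Integration by parts against `tanh⁻¹ y`. -/
theorem integral_wath_mul_deriv {G G' : ℂ → ℂ} {g : ℝ → ℂ}
    (hd : ∀ y ∈ Icc (0 : ℝ) 1, HasDerivAt G (G' y) y)
    (hG' : ContinuousOn (fun y : ℝ => G' y) (Icc 0 1))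
    (hg : ContinuousOn g (Icc 0 1))
    (hfac : ∀ y ∈ Icc (0 : ℝ) 1, G y = (1 - y ^ 2) * g y) :
    ∫ y in (0 : ℝ)..1, wath y * G' y = -∫ y in (0 : ℝ)..1, g y := by
  have e1 := integral_wlogSub_mul_deriv (g := fun y => (1 + y) * g y) hd hG'
    (ContinuousOn.mul (by fun_prop) hg) fun y hy => by rw [hfac y hy]; ring
  have e2 := integral_wlogAdd_mul_deriv (g := fun y => (1 - y) * g y) hd hG'
    (ContinuousOn.mul (by fun_prop) hg) (fun y hy => by rw [hfac y hy]; ring)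
    (by have := hfac 1 (by simp); push_cast at this; rw [this]; ring)
  have c1 := intervalIntegrable_wlogSub.mul_continuousOn_zero_one hG'
  have c2 := intervalIntegrable_wlogAdd.mul_continuousOn_zero_one hG'
  have hpoly : ∀ q : ℝ → ℂ, Continuous q → IntervalIntegrable (fun y => q y * g y) volume 0 1 :=
    fun q hq => (hq.continuousOn.mul hg).intervalIntegrable_zero_one
  have d1 := hpoly (fun y => 1 + y) (by fun_prop)
  have d2 := hpoly (fun y => 1 - y) (by fun_prop)
  calc ∫ y in (0 : ℝ)..1, wath y * G' y
      = ∫ y in (0 : ℝ)..1, (2⁻¹ * (wlogAdd y * G' y - wlogSub y * G' y)) := by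
        congr 1; ext y; simp only [wath]; ring
    _ = 2⁻¹ * (-(∫ y in (0 : ℝ)..1, (1 - y) * g y) - (∫ y in (0 : ℝ)..1, (1 + y) * g y)) := by
        rw [intervalIntegral.integral_const_mul, intervalIntegral.integral_sub c2 c1, e1, e2]
    _ = -∫ y in (0 : ℝ)..1, g y := by
        rw [← neg_add', ← intervalIntegral.integral_add d2 d1, mul_neg,
          ← intervalIntegral.integral_const_mul]
        congr 2; ext y; ring

/-! ### The dilogarithm on the plane slit along `[1, ∞)` -/

theorem one_sub_mul_mem_slitPlane {z : ℂ} (hz : 1 - z ∈ slitPlane) {t : ℝ} (ht : t ∈ Icc (0 : ℝ) 1) :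
    1 - z * t ∈ slitPlane := by
  have h := Complex.starConvex_one_slitPlane hz (sub_nonneg.2 ht.2) ht.1 (by ring)
  convert! h using 1
  simp only [Complex.real_smul]; push_cast; ring

theorem one_add_mul_mem_slitPlane {z : ℂ} (hz : 1 + z ∈ slitPlane) {t : ℝ} (ht : t ∈ Icc (0 : ℝ) 1) :
    1 + z * t ∈ slitPlane := by
  have := one_sub_mul_mem_slitPlane (z := -z) (by simpa using hz) ht
  simpa using this

/-- Integration by parts replaces the factor 1/t by the fixed integrable weight log t against a
kernel smooth in z and t, so that `hasDerivAt_integral_mul_kernel` applies. -/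
theorem Li2_eq_integral {z : ℂ} (hz : 1 - z ∈ slitPlane) :
    Li2 z = -∫ t in (0 : ℝ)..1, wlog t * (z / (1 - z * t)) := by
  have hs : ∀ t ∈ Icc (0 : ℝ) 1, 1 - z * t ∈ slitPlane := fun t ht =>
    one_sub_mul_mem_slitPlane hz ht
  set G : ℂ → ℂ := fun t => Complex.log (1 - z * t) with hG
  have hd : ∀ t ∈ Icc (0 : ℝ) 1, HasDerivAt G (-z / (1 - z * t)) t := fun t ht => by
    have : HasDerivAt (fun t : ℂ => 1 - z * t) (-z) t := by
      simpa using ((hasDerivAt_id (t : ℂ)).const_mul z).const_sub 1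
    exact this.clog (hs t ht)
  -- `dslope G 0` is the continuous extension of log(1 - zt)/t to t = 0, where the literal quotient
  -- is 0 by convention; the two agree on (0,1], which is enough for the integral.
  have hcont : ContinuousOn (fun t : ℝ => dslope G 0 t) (Icc 0 1) := by
    intro t ht
    have hda : DifferentiableAt ℂ G t := (hd t ht).differentiableAt
    have h0 : DifferentiableAt ℂ G 0 := by
      simpa using (hd 0 (by simp)).differentiableAt
    have : ContinuousAt (dslope G 0) (t : ℂ) := by
      rcases eq_or_ne (t : ℂ) 0 with h | h
      · rw [h]; exact continuousAt_dslope_same.2 h0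
      · exact (continuousAt_dslope_of_ne h).2 hda.continuousAt
    exact (this.comp (f := fun t : ℝ => (t : ℂ))
      Complex.continuous_ofReal.continuousAt).continuousWithinAt
  have key := integral_wlog_mul_deriv (G' := fun t => -z / (1 - z * t)) hd
    (ContinuousOn.div (by fun_prop) (by fun_prop) fun t ht => Complex.slitPlane_ne_zero (hs t ht))
    hcont (fun t ht => by
      have := sub_smul_dslope G 0 (t : ℂ)
      simp only [sub_zero, smul_eq_mul] at this
      rw [this]; simp [hG])
  have e : Li2 z = -∫ t in (0 : ℝ)..1, dslope G 0 t := by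
    rw [Li2]
    congr 1
    refine intervalIntegral.integral_congr_ae (Eventually.of_forall fun t ht => ?_)
    rw [uIoc_of_le zero_le_one] at ht
    have : (t : ℂ) ≠ 0 := by exact_mod_cast ht.1.ne'
    rw [dslope_of_ne _ this, slope_def_field]
    simp [hG]
  rw [e, ← key, ← intervalIntegral.integral_neg]
  congr 1; ext t; ring

theorem isOpen_one_sub_mem_slitPlane : IsOpen {z : ℂ | 1 - z ∈ slitPlane} :=
  Complex.isOpen_slitPlane.preimage (by fun_prop)

theorem hasDerivAt_Li2 {z : ℂ} (hz : 1 - z ∈ slitPlane) (h0 : z ≠ 0) :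
    HasDerivAt Li2 (-Complex.log (1 - z) / z) z := by
  have hU := isOpen_one_sub_mem_slitPlane
  have hs : ∀ z : ℂ, 1 - z ∈ slitPlane → ∀ t ∈ Icc (0 : ℝ) 1, 1 - z * t ≠ 0 := fun z hz t ht =>
    Complex.slitPlane_ne_zero (one_sub_mul_mem_slitPlane hz ht)
  have h := hasDerivAt_integral_mul_kernel hU intervalIntegrable_wlog
    (K := fun z t => z / (1 - z * t)) (K' := fun z t => 1 / (1 - z * t) ^ 2)
    (fun z hz => ContinuousOn.div (by fun_prop) (by fun_prop) (hs z hz))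
    (ContinuousOn.div (by fun_prop) (by fun_prop) fun p hp => pow_ne_zero 2 (hs p.1 hp.1 p.2 hp.2))
    (fun z hz t ht => by
      have h1 : HasDerivAt (fun z : ℂ => 1 - z * t) (-t) z := by
        simpa using ((hasDerivAt_id z).mul_const (t : ℂ)).const_sub 1
      convert! (hasDerivAt_id z).div h1 (hs z hz t ht) using 1
      simp only [id]; ring) hz
  -- After differentiation in z the kernel is itself a t-derivative, of t/(1 - zt); integrating by
  -- parts back removes the logarithmic weight.
  have e1 := integral_wlog_mul_deriv (G := fun t => t / (1 - z * t))
    (G' := fun t => 1 / (1 - z * t) ^ 2) (g := fun t => 1 / (1 - z * t))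
    (fun t ht => by
      have h1 : HasDerivAt (fun t : ℂ => 1 - z * t) (-z) t := by
        simpa using ((hasDerivAt_id (t : ℂ)).const_mul z).const_sub 1
      convert! (hasDerivAt_id (t : ℂ)).div h1 (hs z hz t ht) using 1
      simp only [id]; ring)
    (ContinuousOn.div (by fun_prop) (by fun_prop) fun t ht => pow_ne_zero 2 (hs z hz t ht))
    (ContinuousOn.div (by fun_prop) (by fun_prop) (hs z hz))
    (fun t ht => by ring)
  have e2 : ∫ t in (0 : ℝ)..1, 1 / (1 - z * (t : ℂ)) = -Complex.log (1 - z) / z := by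
    have := intervalIntegral.integral_eq_sub_of_hasDerivAt (a := 0) (b := 1)
      (f := fun t : ℝ => -Complex.log (1 - z * t) / z) (f' := fun t : ℝ => 1 / (1 - z * (t : ℂ)))
      (fun t ht => by
        rw [uIcc_of_le zero_le_one] at ht
        have h1 : HasDerivAt (fun t : ℂ => 1 - z * t) (-z) t := by
          simpa using ((hasDerivAt_id (t : ℂ)).const_mul z).const_sub 1
        have h2 := ((h1.clog (one_sub_mul_mem_slitPlane hz ht)).neg.div_const z).comp_ofReal
        convert! h2 using 1
        field_simp)
      (ContinuousOn.div (by fun_prop) (by fun_prop) (hs z hz)).intervalIntegrable_zero_one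
    rw [this]; simp
  rw [← e2]
  have h' := h.neg
  rw [e1, neg_neg] at h'
  refine h'.congr_of_eventuallyEq ?_
  filter_upwards [hU.mem_nhds hz] with w hw
  exact Li2_eq_integral hw

/-! ### Kernels on the plane slit along `(-∞, -1]` and `[1, ∞)` -/

/-- The plane slit along `(-∞, -1]` and `[1, ∞)`. -/
def cutPlane : Set ℂ := {z | 1 + z ∈ slitPlane ∧ 1 - z ∈ slitPlane}

theorem isOpen_cutPlane : IsOpen cutPlane :=
  (Complex.isOpen_slitPlane.preimage (by fun_prop : Continuous fun z : ℂ => 1 + z)).inter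
    isOpen_one_sub_mem_slitPlane

theorem zero_mem_cutPlane : (0 : ℂ) ∈ cutPlane := by simp [cutPlane]

theorem isPreconnected_cutPlane : IsPreconnected cutPlane := by
  have : StarConvex ℝ (0 : ℂ) cutPlane := by
    rw [starConvex_zero_iff]
    intro z hz t h0 h1
    rw [Complex.real_smul, mul_comm]
    exact ⟨one_add_mul_mem_slitPlane hz.1 ⟨h0, h1⟩, one_sub_mul_mem_slitPlane hz.2 ⟨h0, h1⟩⟩
  exact (this.isPathConnected zero_mem_cutPlane).isConnected.isPreconnected

theorem neg_mem_cutPlane {z : ℂ} (hz : z ∈ cutPlane) : -z ∈ cutPlane := by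
  refine ⟨?_, ?_⟩
  · simpa [← sub_eq_add_neg] using hz.2
  · simpa using hz.1

theorem one_sub_sq_mul_sq_ne_zero {z : ℂ} (hz : z ∈ cutPlane) :
    ∀ t ∈ Icc (0 : ℝ) 1, (1 - z ^ 2 * (t : ℂ) ^ 2) ≠ 0 := fun t ht => by
  have h1 := Complex.slitPlane_ne_zero (one_add_mul_mem_slitPlane hz.1 ht)
  have h2 := Complex.slitPlane_ne_zero (one_sub_mul_mem_slitPlane hz.2 ht)
  have : 1 - z ^ 2 * (t : ℂ) ^ 2 = (1 + z * t) * (1 - z * t) := by ring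
  rw [this]
  exact mul_ne_zero h1 h2

/-- This is how the integral evaluations below are proved: equal derivatives on a connected set and
equal values at 0. -/
theorem eqOn_cutPlane {f g h : ℂ → ℂ} (hf : ∀ z ∈ cutPlane, HasDerivAt f (h z) z)
    (hg : ∀ z ∈ cutPlane, HasDerivAt g (h z) z) (h0 : f 0 = g 0) {z : ℂ} (hz : z ∈ cutPlane) :
    f z = g z :=
  isOpen_cutPlane.eqOn_of_deriv_eq isPreconnected_cutPlane
    (fun z hz => (hf z hz).differentiableAt.differentiableWithinAt)
    (fun z hz => (hg z hz).differentiableAt.differentiableWithinAt)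
    (fun z hz => by rw [(hf z hz).deriv, (hg z hz).deriv]) zero_mem_cutPlane h0 hz

theorem hasDerivAt_log_one_add {z : ℂ} (hz : 1 + z ∈ slitPlane) :
    HasDerivAt (fun z => Complex.log (1 + z)) (1 / (1 + z)) z :=
  ((hasDerivAt_id z).const_add 1).clog hz

theorem hasDerivAt_log_one_sub {z : ℂ} (hz : 1 - z ∈ slitPlane) :
    HasDerivAt (fun z => Complex.log (1 - z)) (-1 / (1 - z)) z :=
  ((hasDerivAt_id z).const_sub 1).clog hz

theorem hasDerivAt_arctanh {z : ℂ} (hz : z ∈ cutPlane) :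
    HasDerivAt arctanh (1 / (1 - z ^ 2)) z := by
  have h := ((hasDerivAt_log_one_add hz.1).sub (hasDerivAt_log_one_sub hz.2)).div_const 2
  convert! h using 1
  have h1 := Complex.slitPlane_ne_zero hz.1
  have h2 := Complex.slitPlane_ne_zero hz.2
  have : 1 - z ^ 2 = (1 + z) * (1 - z) := by ring
  rw [this]; field_simp; ring

/-! ### Evaluation of the kernel integrals -/

/-- `∫₀¹ W(y) 2z / (1 - z² y²) dy`. -/
noncomputable def kernelInt (W : ℝ → ℂ) (z : ℂ) : ℂ :=
  ∫ y in (0 : ℝ)..1, W y * (2 * z / (1 - z ^ 2 * y ^ 2))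

theorem kernelInt_one {z : ℂ} (hz : z ∈ cutPlane) :
    kernelInt (fun _ => 1) z = 2 * arctanh z := by
  have := intervalIntegral.integral_eq_sub_of_hasDerivAt (a := 0) (b := 1)
      (f := fun t : ℝ => Complex.log (1 + z * t) - Complex.log (1 - z * t))
      (f' := fun t : ℝ => 1 * (2 * z / (1 - z ^ 2 * (t : ℂ) ^ 2)))
      (fun t ht => by
        rw [uIcc_of_le zero_le_one] at ht
        have h1 : HasDerivAt (fun t : ℂ => 1 - z * t) (-z) t := by
          simpa using ((hasDerivAt_id (t : ℂ)).const_mul z).const_sub 1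
        have h1' : HasDerivAt (fun t : ℂ => 1 + z * t) z t := by
          simpa using ((hasDerivAt_id (t : ℂ)).const_mul z).const_add 1
        have m1 := one_add_mul_mem_slitPlane hz.1 ht
        have m2 := one_sub_mul_mem_slitPlane hz.2 ht
        have h2 := ((h1'.clog m1).sub (h1.clog m2)).comp_ofReal
        convert! h2 using 1
        have n1 := Complex.slitPlane_ne_zero m1
        have n2 := Complex.slitPlane_ne_zero m2
        have : 1 - z ^ 2 * (t : ℂ) ^ 2 = (1 + z * t) * (1 - z * t) := by ring
        rw [this]
        field_simp
        ring)
      (ContinuousOn.mul (by fun_prop) (ContinuousOn.div (by fun_prop) (by fun_prop)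
        (one_sub_sq_mul_sq_ne_zero hz))).intervalIntegrable_zero_one
  rw [kernelInt, this, arctanh]
  simp
  ring

/-- The kernel splits as z/(1 - zt) + z/(1 + zt), and each half is a dilogarithm by
`Li2_eq_integral`. -/
theorem kernelInt_wlog {z : ℂ} (hz : z ∈ cutPlane) :
    kernelInt wlog z = Li2 (-z) - Li2 z := by
  have hz' := neg_mem_cutPlane hz
  have hi : ∀ w ∈ cutPlane, IntervalIntegrable (fun t => wlog t * (w / (1 - w * t))) volume 0 1 :=
    fun w hw => intervalIntegrable_wlog.mul_continuousOn_zero_one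
      (ContinuousOn.div (by fun_prop) (by fun_prop) fun t ht =>
        Complex.slitPlane_ne_zero (one_sub_mul_mem_slitPlane hw.2 ht))
  rw [Li2_eq_integral hz'.2, Li2_eq_integral hz.2, neg_sub_neg,
    ← intervalIntegral.integral_sub (hi z hz) (hi _ hz'), kernelInt]
  refine intervalIntegral.integral_congr fun t ht => ?_
  rw [uIcc_of_le zero_le_one] at ht
  have n1 := Complex.slitPlane_ne_zero (one_add_mul_mem_slitPlane hz.1 ht)
  have n2 := Complex.slitPlane_ne_zero (one_sub_mul_mem_slitPlane hz.2 ht)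
  have : 1 - z ^ 2 * (t : ℂ) ^ 2 = (1 + z * t) * (1 - z * t) := by ring
  have n3 : 1 - -z * t ≠ 0 := by simpa using n1
  have e3 : 1 - -z * t = 1 + z * t := by ring
  simp only [this, e3]
  field_simp
  ring

theorem hasDerivAt_one_sub_sq_mul_sq (z t : ℂ) :
    HasDerivAt (fun z : ℂ => 1 - z ^ 2 * t ^ 2) (-(2 * z * t ^ 2)) z := by
  simpa using (((hasDerivAt_pow 2 z).mul_const (t ^ 2))).const_sub 1

theorem hasDerivAt_one_sub_sq_mul_sq' (z t : ℂ) :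
    HasDerivAt (fun t : ℂ => 1 - z ^ 2 * t ^ 2) (-(2 * t * z ^ 2)) t := by
  convert! hasDerivAt_one_sub_sq_mul_sq t z using 1
  ext u; ring

theorem integral_one_div_one_sub {z : ℂ} (hz : z ∈ cutPlane) :
    z * ∫ y in (0 : ℝ)..1, 1 / (1 - z ^ 2 * (y : ℂ) ^ 2) = arctanh z := by
  have h := kernelInt_one hz
  have : kernelInt (fun _ => 1) z = 2 * (z * ∫ y in (0 : ℝ)..1, 1 / (1 - z ^ 2 * (y : ℂ) ^ 2)) := by
    rw [kernelInt, ← intervalIntegral.integral_const_mul, ← intervalIntegral.integral_const_mul]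
    congr 1; ext y; ring
  rw [this] at h
  exact mul_left_cancel₀ two_ne_zero h

theorem integral_one_div_one_add :
    ∫ y in (0 : ℝ)..1, 1 / (1 + (y : ℂ)) = Complex.log 2 := by
  have := intervalIntegral.integral_eq_sub_of_hasDerivAt (a := 0) (b := 1)
    (f := fun t : ℝ => Complex.log (1 + t)) (f' := fun t : ℝ => 1 / (1 + (t : ℂ)))
    (fun t ht => by
      rw [uIcc_of_le zero_le_one] at ht
      exact (hasDerivAt_log_one_add (z := (t : ℂ)) (Or.inl (by simp; linarith [ht.1]))).comp_ofReal)
    (ContinuousOn.div (by fun_prop) (by fun_prop) fun t ht => by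
      have : (1 + t : ℝ) ≠ 0 := by linarith [ht.1]
      exact_mod_cast this).intervalIntegrable_zero_one
  rw [this]
  norm_num

theorem hasDerivAt_kernelInt {W : ℝ → ℂ} (hW : IntervalIntegrable W volume 0 1) {z : ℂ}
    (hz : z ∈ cutPlane) :
    HasDerivAt (kernelInt W)
      (∫ y in (0 : ℝ)..1, W y * (2 * (1 + z ^ 2 * y ^ 2) / (1 - z ^ 2 * y ^ 2) ^ 2)) z := by
  have hs := fun (z : ℂ) (hz : z ∈ cutPlane) => one_sub_sq_mul_sq_ne_zero hz
  exact hasDerivAt_integral_mul_kernel isOpen_cutPlane hW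
    (K := fun z t => 2 * z / (1 - z ^ 2 * t ^ 2))
    (K' := fun z t => 2 * (1 + z ^ 2 * t ^ 2) / (1 - z ^ 2 * t ^ 2) ^ 2)
    (fun z hz => ContinuousOn.div (by fun_prop) (by fun_prop) (hs z hz))
    (ContinuousOn.div (by fun_prop) (by fun_prop) fun p hp => pow_ne_zero 2 (hs p.1 hp.1 p.2 hp.2))
    (fun z hz t ht => by
      convert! ((hasDerivAt_id z).const_mul 2).div (hasDerivAt_one_sub_sq_mul_sq z t)
        (hs z hz t ht) using 1
      simp only [id]; ring) hz

/-- The function `B` in the variable `1 / x`. -/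
noncomputable def betaInv (z : ℂ) : ℂ :=
  Li2 ((z - 1) / (z + 1)) - Li2 ((z + 1) / (z - 1))
    + Complex.log (1 + z) ^ 2 - Complex.log (1 - z) ^ 2

theorem two_div_mem_slitPlane {w : ℂ} (hw : w ∈ slitPlane) : 2 / w ∈ slitPlane := by
  rw [Complex.mem_slitPlane_iff] at hw ⊢
  have h0 : 0 < Complex.normSq w := Complex.normSq_pos.2 (Complex.slitPlane_ne_zero hw)
  rw [div_eq_mul_inv]
  simp only [Complex.mul_re, Complex.mul_im, Complex.inv_re, Complex.inv_im, Complex.re_ofNat,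
    Complex.im_ofNat, zero_mul, sub_zero, add_zero]
  rcases hw with h | h
  · left; positivity
  · right
    have := h0.ne'
    simp [h, this]

theorem log_two_div {w : ℂ} (hw : w ∈ slitPlane) :
    Complex.log (2 / w) = Complex.log 2 - Complex.log w := by
  have h := Complex.log_ofReal_mul (r := 2) two_pos (inv_ne_zero (Complex.slitPlane_ne_zero hw))
  rw [div_eq_mul_inv]
  rw [Complex.ofReal_log two_pos.le] at h
  push_cast at h
  rw [h, Complex.log_inv _ (Complex.slitPlane_arg_ne_pi hw)]
  ring

/-- One minus the argument is 2/(1 + z), which stays in the slit plane together with 1 + z, and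
there log(2/(1 + z)) = log 2 - log(1 + z) without a branch correction. -/
theorem hasDerivAt_Li2_mobius {z : ℂ} (hz : z ∈ cutPlane) :
    HasDerivAt (fun z => Li2 ((z - 1) / (z + 1)))
      ((Complex.log (1 + z) - Complex.log 2) * (2 / (z ^ 2 - 1))) z := by
  have h1 : z + 1 ≠ 0 := by rw [add_comm]; exact Complex.slitPlane_ne_zero hz.1
  have h2 : z - 1 ≠ 0 := by
    have := Complex.slitPlane_ne_zero hz.2
    contrapose! this; linear_combination -this
  have e : 1 - (z - 1) / (z + 1) = 2 / (1 + z) := by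
    rw [add_comm 1 z]; field_simp; ring
  have hL := hasDerivAt_Li2 (z := (z - 1) / (z + 1)) (by rw [e]; exact two_div_mem_slitPlane hz.1)
    (div_ne_zero h2 h1)
  have hm := ((hasDerivAt_id z).sub_const 1).div ((hasDerivAt_id z).add_const 1) h1
  have := HasDerivAt.comp z hL hm
  convert! this using 1
  rw [e, log_two_div hz.1]
  have h3 : z ^ 2 - 1 = (z + 1) * (z - 1) := by ring
  simp only [id]
  rw [h3]; field_simp; ring

theorem hasDerivAt_betaInv {z : ℂ} (hz : z ∈ cutPlane) :
    HasDerivAt betaInv (4 / (1 - z ^ 2) * (Complex.log 2 - z * arctanh z)) z := by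
  have h1 := hasDerivAt_Li2_mobius hz
  -- The second dilogarithm in `betaInv` is the first one with z replaced by -z.
  have h2 := HasDerivAt.comp z (hasDerivAt_Li2_mobius (neg_mem_cutPlane hz)) (hasDerivAt_neg z)
  have h3 := ((h1.sub h2).add ((hasDerivAt_log_one_add hz.1).pow 2)).sub
    ((hasDerivAt_log_one_sub hz.2).pow 2)
  have n1 := Complex.slitPlane_ne_zero hz.1
  have n2 := Complex.slitPlane_ne_zero hz.2
  convert! h3 using 1
  · ext w
    have : (-w - 1) / (-w + 1) = (w + 1) / (w - 1) := by
      rw [show -w - 1 = -(w + 1) by ring, show -w + 1 = -(w - 1) by ring, neg_div_neg_eq]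
    simp [betaInv, this]
  · have e1 : 1 - z ^ 2 = (1 + z) * (1 - z) := by ring
    have e2 : z ^ 2 - 1 = -((1 + z) * (1 - z)) := by ring
    simp only [neg_sq, arctanh, e1, e2, ← sub_eq_add_neg]
    field_simp
    push_cast
    ring

/-- Both sides vanish at 0, so it suffices to compare derivatives. The z-derivative of 2z/(1 - z²y²)
equals the y-derivative of 2y/(1 - z²y²); integrating by parts in y then removes the logarithms and
leaves log 2 and tanh⁻¹ z. -/
theorem kernelInt_well_eq_betaInv {z : ℂ} (hz : z ∈ cutPlane) : kernelInt well z = betaInv z := by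
  refine eqOn_cutPlane (f := kernelInt well) (g := betaInv) (fun z hz => ?_)
    (fun z hz => hasDerivAt_betaInv hz) ?_ hz
  · have h := hasDerivAt_kernelInt intervalIntegrable_well hz
    convert! h using 1
    have hs := one_sub_sq_mul_sq_ne_zero hz
    have n1 := Complex.slitPlane_ne_zero hz.1
    have n2 := Complex.slitPlane_ne_zero hz.2
    have n3 : 1 - z ^ 2 ≠ 0 := by
      rw [show 1 - z ^ 2 = (1 + z) * (1 - z) by ring]; exact mul_ne_zero n1 n2
    have na : ∀ t ∈ Icc (0 : ℝ) 1, (1 + t : ℂ) ≠ 0 := fun t ht => by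
      have : (1 + t : ℝ) ≠ 0 := by linarith [ht.1]
      exact_mod_cast this
    have hG' : ContinuousOn (fun y : ℝ => 2 * (1 + z ^ 2 * (y : ℂ) ^ 2) / (1 - z ^ 2 * y ^ 2) ^ 2)
        (Icc 0 1) :=
      ContinuousOn.div (by fun_prop) (by fun_prop) fun t ht => pow_ne_zero 2 (hs t ht)
    have hd0 : ∀ y ∈ Icc (0 : ℝ) 1, HasDerivAt (fun y : ℂ => 2 * y / (1 - z ^ 2 * y ^ 2))
        (2 * (1 + z ^ 2 * (y : ℂ) ^ 2) / (1 - z ^ 2 * y ^ 2) ^ 2) y := fun y hy => by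
      convert! ((hasDerivAt_id (y : ℂ)).const_mul 2).div (hasDerivAt_one_sub_sq_mul_sq' z y)
        (hs y hy) using 1
      simp only [id]; ring
    -- For log(1 - y) and log(1 + y) the primitive is shifted by a constant so that it vanishes at y
    -- = 1; the unshifted one vanishes at y = 0, as log y requires.
    have hd1 : ∀ y ∈ Icc (0 : ℝ) 1, HasDerivAt
        (fun y : ℂ => 2 * y / (1 - z ^ 2 * y ^ 2) - 2 / (1 - z ^ 2))
        (2 * (1 + z ^ 2 * (y : ℂ) ^ 2) / (1 - z ^ 2 * y ^ 2) ^ 2) y := fun y hy =>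
      (hd0 y hy).sub_const _
    set g : ℝ → ℂ := fun y => -2 * (1 + z ^ 2 * y) / ((1 - z ^ 2 * y ^ 2) * (1 - z ^ 2)) with hg
    have hgc : ContinuousOn g (Icc 0 1) :=
      ContinuousOn.div (by fun_prop) (by fun_prop) fun t ht => mul_ne_zero (hs t ht) n3
    have hfac : ∀ y ∈ Icc (0 : ℝ) 1,
        2 * (y : ℂ) / (1 - z ^ 2 * y ^ 2) - 2 / (1 - z ^ 2) = (1 - y) * g y := fun y hy => by
      have := hs y hy
      simp only [hg]
      generalize hd : 1 - z ^ 2 * (y : ℂ) ^ 2 = d at this ⊢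
      field_simp
      rw [← hd]; ring
    have i0c : ContinuousOn (fun y : ℝ => 2 * (1 / (1 - z ^ 2 * (y : ℂ) ^ 2))) (Icc 0 1) :=
      ContinuousOn.mul (by fun_prop) (ContinuousOn.div (by fun_prop) (by fun_prop) hs)
    have i2c : ContinuousOn (fun y : ℝ => (1 - y) * g y / (1 + (y : ℂ))) (Icc 0 1) :=
      ContinuousOn.div (ContinuousOn.mul (by fun_prop) hgc) (by fun_prop) na
    have e0 := integral_wlog_mul_deriv
      (G' := fun y => 2 * (1 + z ^ 2 * y ^ 2) / (1 - z ^ 2 * y ^ 2) ^ 2) hd0 hG' i0c fun y hy => by ring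
    have e1 := integral_wlogSub_mul_deriv
      (G' := fun y => 2 * (1 + z ^ 2 * y ^ 2) / (1 - z ^ 2 * y ^ 2) ^ 2) hd1 hG' hgc hfac
    have e2 := integral_wlogAdd_mul_deriv
      (G' := fun y => 2 * (1 + z ^ 2 * y ^ 2) / (1 - z ^ 2 * y ^ 2) ^ 2) hd1 hG' i2c
      (fun y hy => by rw [hfac y hy]; have := na y hy; field_simp)
      (by have := hfac 1 (by simp); push_cast at this; rw [this]; ring)
    have c0 := intervalIntegrable_wlog.mul_continuousOn_zero_one hG'
    have c1 := intervalIntegrable_wlogSub.mul_continuousOn_zero_one hG'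
    have c2 := intervalIntegrable_wlogAdd.mul_continuousOn_zero_one hG'
    have d0 := i0c.intervalIntegrable_zero_one
    have d1 := hgc.intervalIntegrable_zero_one
    have d2 := i2c.intervalIntegrable_zero_one
    have da : IntervalIntegrable (fun y : ℝ => 1 / (1 + (y : ℂ))) volume 0 1 :=
      (ContinuousOn.div (by fun_prop) (by fun_prop) na).intervalIntegrable_zero_one
    have db : IntervalIntegrable (fun y : ℝ => 1 / (1 - z ^ 2 * (y : ℂ) ^ 2)) volume 0 1 :=
      (ContinuousOn.div (by fun_prop) (by fun_prop) hs).intervalIntegrable_zero_one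
    symm
    calc ∫ y in (0 : ℝ)..1, well y * (2 * (1 + z ^ 2 * (y : ℂ) ^ 2) / (1 - z ^ 2 * y ^ 2) ^ 2)
        = ∫ y in (0 : ℝ)..1, (wlogSub y * (2 * (1 + z ^ 2 * (y : ℂ) ^ 2) / (1 - z ^ 2 * y ^ 2) ^ 2)
            + wlogAdd y * (2 * (1 + z ^ 2 * (y : ℂ) ^ 2) / (1 - z ^ 2 * y ^ 2) ^ 2)
            - 2 * (wlog y * (2 * (1 + z ^ 2 * (y : ℂ) ^ 2) / (1 - z ^ 2 * y ^ 2) ^ 2))) := by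
          congr 1; ext y; simp only [well]; ring
      _ = (∫ y in (0 : ℝ)..1, g y) - (∫ y in (0 : ℝ)..1, (1 - y) * g y / (1 + (y : ℂ)))
            + 2 * ∫ y in (0 : ℝ)..1, 2 * (1 / (1 - z ^ 2 * (y : ℂ) ^ 2)) := by
          rw [intervalIntegral.integral_sub (c1.add c2) (c0.const_mul 2),
            intervalIntegral.integral_add c1 c2, intervalIntegral.integral_const_mul, e0, e1, e2]
          ring
      _ = 4 / (1 - z ^ 2) * ((∫ y in (0 : ℝ)..1, 1 / (1 + (y : ℂ)))
            - z ^ 2 * ∫ y in (0 : ℝ)..1, 1 / (1 - z ^ 2 * (y : ℂ) ^ 2)) := by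
          rw [← intervalIntegral.integral_sub d1 d2, ← intervalIntegral.integral_const_mul,
            ← intervalIntegral.integral_add (d1.sub d2) (d0.const_mul 2),
            ← intervalIntegral.integral_const_mul (z ^ 2),
            ← intervalIntegral.integral_sub da (db.const_mul _),
            ← intervalIntegral.integral_const_mul]
          refine intervalIntegral.integral_congr fun y hy => ?_
          rw [uIcc_of_le zero_le_one] at hy
          have h1 := hs y hy
          have h2 := na y hy
          simp only [hg]
          generalize hd : 1 - z ^ 2 * (y : ℂ) ^ 2 = d at h1 ⊢
          field_simp
          rw [← hd]
          ring
      _ = _ := by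
          rw [integral_one_div_one_add, ← integral_one_div_one_sub hz]; ring
  · simp [kernelInt, betaInv]

/-- The derivative of either side in z is 2 tanh⁻¹(z)/(1 - z²), and both sides vanish at 0. -/
theorem integral_wath_kernel {z : ℂ} (hz : z ∈ cutPlane) :
    ∫ y in (0 : ℝ)..1, wath y * (2 * z ^ 2 * y / (1 - z ^ 2 * y ^ 2)) = arctanh z ^ 2 := by
  have hs := fun (z : ℂ) (hz : z ∈ cutPlane) => one_sub_sq_mul_sq_ne_zero hz
  refine eqOn_cutPlane (h := fun z => 2 * arctanh z / (1 - z ^ 2))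
    (f := fun z => ∫ y in (0 : ℝ)..1, wath y * (2 * z ^ 2 * y / (1 - z ^ 2 * y ^ 2)))
    (g := fun z => arctanh z ^ 2) (fun z hz => ?_) (fun z hz => ?_) ?_ hz
  · have h := hasDerivAt_integral_mul_kernel isOpen_cutPlane intervalIntegrable_wath
      (K := fun z t => 2 * z ^ 2 * t / (1 - z ^ 2 * t ^ 2))
      (K' := fun z t => 4 * z * t / (1 - z ^ 2 * t ^ 2) ^ 2)
      (fun z hz => ContinuousOn.div (by fun_prop) (by fun_prop) (hs z hz))
      (ContinuousOn.div (by fun_prop) (by fun_prop) fun p hp =>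
        pow_ne_zero 2 (hs p.1 hp.1 p.2 hp.2))
      (fun z hz t ht => by
        convert! (((hasDerivAt_pow 2 z).const_mul 2).mul_const (t : ℂ)).div
          (hasDerivAt_one_sub_sq_mul_sq z t) (hs z hz t ht) using 1
        push_cast; ring) hz
    convert! h using 1
    have n1 := Complex.slitPlane_ne_zero hz.1
    have n2 := Complex.slitPlane_ne_zero hz.2
    have n3 : 1 - z ^ 2 ≠ 0 := by
      rw [show 1 - z ^ 2 = (1 + z) * (1 - z) by ring]; exact mul_ne_zero n1 n2
    rw [integral_wath_mul_deriv
      -- The primitive is normalised to vanish at y = 1, where tanh⁻¹ blows up; in this form it also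
      -- makes sense at z = 0.
      (G := fun y => -2 * z * (1 - y ^ 2) / ((1 - z ^ 2) * (1 - z ^ 2 * y ^ 2)))
      (G' := fun y => 4 * z * y / (1 - z ^ 2 * y ^ 2) ^ 2)
      (g := fun y => -2 * z / ((1 - z ^ 2) * (1 - z ^ 2 * y ^ 2))) (fun y hy => ?_) ?_ ?_ ?_,
      ← integral_one_div_one_sub hz, ← intervalIntegral.integral_neg,
      ← intervalIntegral.integral_const_mul, ← intervalIntegral.integral_const_mul,
      ← intervalIntegral.integral_div]
    · refine intervalIntegral.integral_congr fun y hy => ?_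
      rw [uIcc_of_le zero_le_one] at hy
      have h1 := hs z hz y hy
      field_simp
    · exact ContinuousOn.div (by fun_prop) (by fun_prop) fun t ht => pow_ne_zero 2 (hs z hz t ht)
    · exact ContinuousOn.div (by fun_prop) (by fun_prop) fun t ht => mul_ne_zero n3 (hs z hz t ht)
    · intro y hy
      have h1 := hs z hz y hy
      field_simp
    · have h1 := hs z hz y hy
      convert! ((((hasDerivAt_pow 2 (y : ℂ)).const_sub 1).const_mul (-2 * z))).div
        ((hasDerivAt_one_sub_sq_mul_sq' z y).const_mul (1 - z ^ 2)) (mul_ne_zero n3 h1) using 1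
      push_cast
      field_simp
      ring
  · convert! (hasDerivAt_arctanh hz).pow 2 using 1
    push_cast; ring
  · simp [arctanh]

/-! ### Moments of the weights -/

/-- `∫₀¹ W(y) (1 - y²)^m y^n dy`. -/
noncomputable def moment (W : ℝ → ℂ) (m n : ℕ) : ℂ :=
  ∫ y in (0 : ℝ)..1, W y * ((1 - (y : ℂ) ^ 2) ^ m * (y : ℂ) ^ n)

theorem intervalIntegrable_weight_mul {W : ℝ → ℂ} (hW : IntervalIntegrable W volume 0 1)
    {q : ℝ → ℂ} (hq : Continuous q) : IntervalIntegrable (fun y => W y * q y) volume 0 1 :=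
  hW.mul_continuousOn_zero_one hq.continuousOn

theorem moment_succ_left {W : ℝ → ℂ} (hW : IntervalIntegrable W volume 0 1) (m n : ℕ) :
    moment W (m + 1) n = moment W m n - moment W m (n + 2) := by
  have h1 := intervalIntegrable_weight_mul hW
    (q := fun y => (1 - (y : ℂ) ^ 2) ^ m * (y : ℂ) ^ n) (by fun_prop)
  have h2 := intervalIntegrable_weight_mul hW
    (q := fun y => (1 - (y : ℂ) ^ 2) ^ m * (y : ℂ) ^ (n + 2)) (by fun_prop)
  rw [moment, moment, moment, ← intervalIntegral.integral_sub h1 h2]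
  congr 1; ext y; ring

/-- Writing y² = 1 - (1 - y²) expresses the derivative through exponents with the same n. This
function vanishes at both endpoints, so each weight W yields a recurrence in m whose only extra term
comes from W'. -/
theorem hasDerivAt_moment_primitive (m n : ℕ) (y : ℂ) :
    HasDerivAt (fun y : ℂ => (1 - y ^ 2) ^ (m + 1) * y ^ (n + 1))
      ((2 * m + n + 3) * ((1 - y ^ 2) ^ (m + 1) * y ^ n)
        - 2 * (m + 1) * ((1 - y ^ 2) ^ m * y ^ n)) y := by
  have h := (((hasDerivAt_pow 2 y).const_sub 1).pow (m + 1)).mul (hasDerivAt_pow (n + 1) y)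
  convert! h using 1
  simp only [Nat.add_sub_cancel, Nat.cast_add, Nat.cast_one, Nat.cast_ofNat, Pi.pow_apply]
  ring

theorem integral_weight_mul_moment_deriv {W : ℝ → ℂ} (hW : IntervalIntegrable W volume 0 1)
    (m n : ℕ) :
    ∫ y in (0 : ℝ)..1, W y * ((2 * m + n + 3) * ((1 - (y : ℂ) ^ 2) ^ (m + 1) * (y : ℂ) ^ n)
        - 2 * (m + 1) * ((1 - (y : ℂ) ^ 2) ^ m * (y : ℂ) ^ n))
      = (2 * m + n + 3) * moment W (m + 1) n - 2 * (m + 1) * moment W m n := by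
  have h1 := intervalIntegrable_weight_mul hW
    (q := fun y => (1 - (y : ℂ) ^ 2) ^ (m + 1) * (y : ℂ) ^ n) (by fun_prop)
  have h2 := intervalIntegrable_weight_mul hW
    (q := fun y => (1 - (y : ℂ) ^ 2) ^ m * (y : ℂ) ^ n) (by fun_prop)
  rw [moment, moment, ← intervalIntegral.integral_const_mul, ← intervalIntegral.integral_const_mul,
    ← intervalIntegral.integral_sub (h1.const_mul _) (h2.const_mul _)]
  congr 1; ext y; ring

theorem intervalIntegrable_one : IntervalIntegrable (fun _ : ℝ => (1 : ℂ)) volume 0 1 :=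
  intervalIntegrable_const

theorem moment_one_rec (m n : ℕ) :
    (2 * m + n + 3) * moment (fun _ => 1) (m + 1) n = 2 * (m + 1) * moment (fun _ => 1) m n := by
  have h := integral_weight_mul_moment_deriv intervalIntegrable_one m n
  have h2 := intervalIntegral.integral_eq_sub_of_hasDerivAt (a := 0) (b := 1)
    (fun t _ => (hasDerivAt_moment_primitive m n (t : ℝ)).comp_ofReal)
    (by apply Continuous.intervalIntegrable; fun_prop)
  simp only [one_mul] at h
  rw [h2] at h
  simp at h
  linear_combination -h

theorem moment_one_zero (n : ℕ) : moment (fun _ => 1) 0 n = 1 / (n + 1) := by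
  have h2 := intervalIntegral.integral_eq_sub_of_hasDerivAt (a := 0) (b := 1)
    (fun t _ => ((hasDerivAt_pow (n + 1) ((t : ℝ) : ℂ)).div_const (n + 1 : ℂ)).comp_ofReal)
    (by apply Continuous.intervalIntegrable; fun_prop)
  rw [moment]
  have hn : (n + 1 : ℂ) ≠ 0 := by exact_mod_cast n.succ_ne_zero
  convert! h2 using 1
  · congr 1; ext y; simp; field_simp
  · simp

theorem moment_wlog_rec (m n : ℕ) :
    (2 * m + n + 3) * moment wlog (m + 1) n
      = 2 * (m + 1) * moment wlog m n - moment (fun _ => 1) (m + 1) n := by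
  have h := integral_weight_mul_moment_deriv intervalIntegrable_wlog m n
  rw [integral_wlog_mul_deriv (g := fun y => (1 - (y : ℂ) ^ 2) ^ (m + 1) * (y : ℂ) ^ n)
    (G' := fun y => (2 * m + n + 3) * ((1 - y ^ 2) ^ (m + 1) * y ^ n)
        - 2 * (m + 1) * ((1 - y ^ 2) ^ m * y ^ n))
    (fun y _ => hasDerivAt_moment_primitive m n y) (by fun_prop) (by fun_prop)
    (fun y _ => by ring)] at h
  simp only [moment, one_mul] at h ⊢
  linear_combination -h

theorem moment_wlog_zero (n : ℕ) : moment wlog 0 n = -(1 / (n + 1) ^ 2) := by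
  have hn : (n + 1 : ℂ) ≠ 0 := by exact_mod_cast n.succ_ne_zero
  have h := integral_wlog_mul_deriv (G := fun y => y ^ (n + 1) / (n + 1)) (G' := fun y => y ^ n)
    (g := fun y => (y : ℂ) ^ n / (n + 1)) (fun y _ => by
      convert! (hasDerivAt_pow (n + 1) (y : ℂ)).div_const (n + 1 : ℂ) using 1
      simp only [Nat.add_sub_cancel, Nat.cast_add, Nat.cast_one]; field_simp)
    (by fun_prop) (by fun_prop) (fun y _ => by ring)
  have h1 := moment_one_zero n
  simp only [moment, pow_zero, one_mul] at h1 ⊢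
  rw [h, intervalIntegral.integral_div, h1]
  field_simp

/-- The extra term arises because the weight has derivative -2/(y(1 - y²)), which lowers both
exponents of the primitive by one. -/
theorem moment_well_rec (m n : ℕ) :
    (2 * m + n + 3) * moment well (m + 1) n
      = 2 * (m + 1) * moment well m n + 2 * moment (fun _ => 1) m n := by
  have h := integral_weight_mul_moment_deriv intervalIntegrable_well m n
  rw [integral_well_mul_deriv (g := fun y => (1 - (y : ℂ) ^ 2) ^ m * (y : ℂ) ^ n)
    (G' := fun y => (2 * m + n + 3) * ((1 - y ^ 2) ^ (m + 1) * y ^ n)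
        - 2 * (m + 1) * ((1 - y ^ 2) ^ m * y ^ n))
    (fun y _ => hasDerivAt_moment_primitive m n y) (by fun_prop) (by fun_prop)
    (fun y _ => by ring)] at h
  simp only [moment, one_mul] at h ⊢
  linear_combination -h

theorem moment_well_zero_zero : moment well 0 0 = 2 * Complex.log 2 := by
  have na : ∀ t ∈ Icc (0 : ℝ) 1, (1 + t : ℂ) ≠ 0 := fun t ht => by
    have : (1 + t : ℝ) ≠ 0 := by linarith [ht.1]
    exact_mod_cast this
  have hc : ContinuousOn (fun y : ℝ => 1 / (1 + (y : ℂ))) (Icc 0 1) :=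
    ContinuousOn.div (by fun_prop) (by fun_prop) na
  have e0 := moment_wlog_zero 0
  have hd : ∀ y ∈ Icc (0 : ℝ) 1, HasDerivAt (fun y : ℂ => y - 1) 1 y :=
    fun y _ => (hasDerivAt_id (y : ℂ)).sub_const 1
  have e1 := integral_wlogSub_mul_deriv (G' := fun _ => 1) (g := fun _ => -1) hd (by fun_prop) (by fun_prop)
    (fun y _ => by ring)
  have e2 := integral_wlogAdd_mul_deriv (G' := fun _ => 1)
    (g := fun y => 1 - 2 * (1 / (1 + (y : ℂ)))) hd (by fun_prop)
    (ContinuousOn.sub (by fun_prop) (ContinuousOn.mul (by fun_prop) hc))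
    (fun y hy => by have := na y hy; field_simp; ring) (by simp)
  rw [intervalIntegral.integral_sub intervalIntegrable_one
    (hc.intervalIntegrable_zero_one.const_mul 2), intervalIntegral.integral_const_mul,
    integral_one_div_one_add] at e2
  simp only [moment, pow_zero, mul_one] at e0 e1 e2 ⊢
  simp only [well]
  rw [intervalIntegral.integral_sub (intervalIntegrable_wlogSub.add intervalIntegrable_wlogAdd)
    (intervalIntegrable_wlog.const_mul 2),
    intervalIntegral.integral_add intervalIntegrable_wlogSub intervalIntegrable_wlogAdd,
    intervalIntegral.integral_const_mul, e0, e1, e2]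
  simp
  ring

/-! ### Closed forms of the moments -/

/-- `∑_{i < N} 1 / (2 i + 1)`. -/
noncomputable def oddSum (N : ℕ) : ℂ := ∑ i ∈ Finset.range N, 1 / (2 * (i : ℂ) + 1)

theorem oddSum_succ (N : ℕ) : oddSum (N + 1) = oddSum N + 1 / (2 * N + 1) :=
  Finset.sum_range_succ _ _

theorem H_zero : H 0 = 0 := by simp [H]

theorem H_succ (n : ℕ) : H (n + 1) = H n + 1 / (n + 1) := by
  simp [H, harmonic_succ]

theorem two_mul_add_one_ne_zero (N : ℕ) : (2 * N + 1 : ℂ) ≠ 0 := by exact_mod_cast (2 * N).succ_ne_zero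

theorem oddSum_eq (N : ℕ) : oddSum N = H (2 * N) - H N / 2 := by
  induction N with
  | zero => simp [oddSum, H_zero]
  | succ N ih =>
    rw [oddSum_succ, ih, show 2 * (N + 1) = 2 * N + 1 + 1 by ring, H_succ (2 * N + 1), H_succ (2 * N),
      H_succ N]
    have h1 := two_mul_add_one_ne_zero N
    have h2 : (N + 1 : ℂ) ≠ 0 := by exact_mod_cast N.succ_ne_zero
    have h3 : (2 * N + 1 + 1 : ℂ) ≠ 0 := by exact_mod_cast (2 * N + 1).succ_ne_zero
    push_cast
    field_simp
    ring

theorem two_mul_add_three_ne_zero (m n : ℕ) : (2 * m + n + 3 : ℂ) ≠ 0 := by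
  exact_mod_cast (2 * m + n + 2).succ_ne_zero

/-- A log y weight is the derivative of the Beta integral in the exponent of y, hence a logarithmic
derivative times the Beta value; the difference of odd harmonic sums is that logarithmic derivative.
The induction only compares the recurrences in m. -/
theorem moment_wlog_eq (m j : ℕ) :
    moment wlog m (2 * j) = -(moment (fun _ => 1) m (2 * j) * (oddSum (m + j + 1) - oddSum j)) := by
  induction m with
  | zero =>
    rw [moment_wlog_zero, moment_one_zero, zero_add, oddSum_succ]
    have h1 := two_mul_add_one_ne_zero j
    push_cast
    field_simp
    ring
  | succ m ih =>
    have h1 := moment_one_rec m (2 * j)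
    have h2 := moment_wlog_rec m (2 * j)
    have h0 := two_mul_add_three_ne_zero m (2 * j)
    have h3 : oddSum (m + 1 + j + 1) = oddSum (m + j + 1) + 1 / (2 * m + (2 * j : ℕ) + 3) := by
      rw [show m + 1 + j + 1 = (m + j + 1) + 1 by ring, oddSum_succ]
      push_cast; ring
    have h4 : (2 * m + (2 * j : ℕ) + 3 : ℂ) * (1 / (2 * m + (2 * j : ℕ) + 3)) = 1 := by
      field_simp
    refine mul_left_cancel₀ h0 ?_
    rw [h2, ih, h3]
    linear_combination (oddSum (m + j + 1) - oddSum j) * h1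
      + moment (fun _ => 1) (m + 1) (2 * j) * h4

theorem moment_well_eq (m j : ℕ) :
    moment well m (2 * j)
      = moment (fun _ => 1) m (2 * j) * (H m - 2 * oddSum j + 2 * Complex.log 2) := by
  induction m with
  | zero =>
    induction j with
    | zero => simp [moment_well_zero_zero, H_zero, oddSum, moment_one_zero]
    | succ j ih =>
      -- At m = 0 the recurrence, with its left moment split by `moment_succ_left`, becomes a
      -- recurrence in j.
      have h1 := moment_well_rec 0 (2 * j)
      rw [moment_succ_left intervalIntegrable_well, ih] at h1
      have e1 := two_mul_add_one_ne_zero j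
      have e2 := two_mul_add_one_ne_zero (j + 1)
      rw [show 2 * (j + 1) = 2 * j + 2 by ring]
      rw [oddSum_succ, moment_one_zero] at *
      push_cast at *
      have e3 : (2 * (j : ℂ) + 2 + 1) ≠ 0 := by convert e2 using 1; ring
      refine mul_left_cancel₀ e3 ?_
      field_simp at h1 ⊢
      linear_combination -h1
  | succ m ih =>
    have h1 := moment_one_rec m (2 * j)
    have h2 := moment_well_rec m (2 * j)
    have h0 := two_mul_add_three_ne_zero m (2 * j)
    have h4 : (m + 1 : ℂ) ≠ 0 := by exact_mod_cast m.succ_ne_zero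
    refine mul_left_cancel₀ h0 ?_
    rw [h2, ih, H_succ]
    field_simp
    linear_combination -(1 + (m + 1) * (H m - 2 * oddSum j + 2 * Complex.log 2)) * h1

/-- This is the Beta value B(j + 1/2, m + 1)/2 written with factorials. -/
theorem moment_one_eq (m j : ℕ) :
    moment (fun _ => 1) m (2 * j)
      = 4 ^ m * m ! * (2 * j)! * (m + j)! / (j ! * (2 * m + 2 * j + 1)!) := by
  have hf : ∀ n : ℕ, (n ! : ℂ) ≠ 0 := fun n => by exact_mod_cast n.factorial_ne_zero
  induction m with
  | zero =>
    have := two_mul_add_one_ne_zero j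
    rw [moment_one_zero]
    simp only [mul_zero, zero_add, Nat.factorial_succ (2 * j)]
    have h1 := hf j
    have h2 := hf (2 * j)
    push_cast
    field_simp
    simp
  | succ m ih =>
    have h1 := moment_one_rec m (2 * j)
    have h0 := two_mul_add_three_ne_zero m (2 * j)
    refine mul_left_cancel₀ h0 ?_
    have e1 := hf j
    have e2 := hf (2 * m + 2 * j + 1)
    have e3 : (m + j + 1 : ℂ) ≠ 0 := by exact_mod_cast (m + j).succ_ne_zero
    have e4 : ((2 * (m + 1) + 2 * j + 1)! : ℂ)
        = (2 * m + (2 * j : ℕ) + 3) * (2 * (m + j + 1)) * (2 * m + 2 * j + 1)! := by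
      rw [show 2 * (m + 1) + 2 * j + 1 = (2 * m + 2 * j + 1 + 1) + 1 by ring,
        Nat.factorial_succ (2 * m + 2 * j + 1 + 1), Nat.factorial_succ (2 * m + 2 * j + 1)]
      push_cast; ring
    rw [h1, ih, e4, show m + 1 + j = m + j + 1 by ring, Nat.factorial_succ m,
      Nat.factorial_succ (m + j)]
    push_cast at h0 ⊢
    generalize (2 * m + 2 * j + 3 : ℂ) = d at h0 ⊢
    field_simp
    ring

/-- The coefficient `16^k C(2k,k) / (C(3k,k) C(6k,3k))`. -/
noncomputable def coeff (k : ℕ) : ℂ :=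
  16 ^ k * ((2 * k).choose k : ℂ) / (((3 * k).choose k : ℂ) * ((6 * k).choose (3 * k) : ℂ))

theorem coeff_eq (k : ℕ) :
    coeff k = 16 ^ k * (2 * k)! * (2 * k)! * (3 * k)! / (k ! * (6 * k)!) := by
  have hf : ∀ n : ℕ, (n ! : ℂ) ≠ 0 := fun n => by exact_mod_cast n.factorial_ne_zero
  have h2 : ((2 * k).choose k : ℂ) * k ! * k ! = (2 * k)! := by
    have := Nat.add_choose_mul_factorial_mul_factorial k k
    rw [← two_mul] at this; exact_mod_cast this
  have h3 : ((3 * k).choose k : ℂ) * k ! * (2 * k)! = (3 * k)! := by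
    have := Nat.choose_mul_factorial_mul_factorial (show k ≤ 3 * k by lia)
    rw [show 3 * k - k = 2 * k by lia] at this; exact_mod_cast this
  have h6 : ((6 * k).choose (3 * k) : ℂ) * (3 * k)! * (3 * k)! = (6 * k)! := by
    have := Nat.add_choose_mul_factorial_mul_factorial (3 * k) (3 * k)
    rw [show 3 * k + 3 * k = 6 * k by ring] at this; exact_mod_cast this
  have c3 : ((3 * k).choose k : ℂ) ≠ 0 := by
    intro h; rw [h] at h3; simp at h3; exact hf _ h3.symm
  have c6 : ((6 * k).choose (3 * k) : ℂ) ≠ 0 := by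
    intro h; rw [h] at h6; simp at h6; exact hf _ h6.symm
  have f1 := hf k
  have f2 := hf (2 * k)
  have f3 := hf (3 * k)
  rw [coeff, ← h6, div_eq_div_iff (mul_ne_zero c3 c6)
    (mul_ne_zero f1 (mul_ne_zero (mul_ne_zero c6 f3) f3))]
  linear_combination
    (-(16 ^ k * ((2 * k).choose k : ℂ) * k ! * (6 * k).choose (3 * k) * (3 * k)!)) * h3
    + (16 ^ k * ((2 * k)! : ℂ) * (3 * k)! * (3 * k).choose k * (6 * k).choose (3 * k)) * h2

/-- This diagonal value links the binomial series to the integrals; the other moments needed are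
obtained from it, or from neighbouring ones, by rational factors. -/
theorem moment_one_coeff (k : ℕ) :
    moment (fun _ => 1) (2 * k) (2 * k) = coeff k / (6 * k + 1) := by
  rw [moment_one_eq, coeff_eq, show 2 * k + k = 3 * k by ring,
    show 2 * (2 * k) + 2 * k + 1 = 6 * k + 1 by ring, Nat.factorial_succ (6 * k), pow_mul]
  have h1 : (6 * k + 1 : ℂ) ≠ 0 := by exact_mod_cast (6 * k).succ_ne_zero
  have h2 : ((6 * k)! : ℂ) ≠ 0 := by exact_mod_cast (6 * k).factorial_ne_zero
  have h3 : (k ! : ℂ) ≠ 0 := by exact_mod_cast k.factorial_ne_zero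
  push_cast
  norm_num
  field_simp

/-! ### Generating functions of the moments -/

/-- The maximum is attained at y² = 1/3; its value is the square of the constant that defines
`region`. -/
theorem sq_cubic_le {y : ℝ} (hy : y ∈ Icc (0 : ℝ) 1) : (y * (1 - y ^ 2)) ^ 2 ≤ 4 / 27 := by
  have h : 4 / 27 - (y * (1 - y ^ 2)) ^ 2 = (y ^ 2 - 1 / 3) ^ 2 * (4 / 3 - y ^ 2) := by ring
  have h2 : y ^ 2 ≤ 1 := by nlinarith [hy.1, hy.2]
  have h3 : 0 ≤ (y ^ 2 - 1 / 3) ^ 2 * (4 / 3 - y ^ 2) :=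
    mul_nonneg (sq_nonneg _) (by linarith)
  linarith

theorem norm_cubic_sq_lt {c : ℂ} (hc : 4 / 27 < ‖c‖ ^ 2) {y : ℝ} (hy : y ∈ Icc (0 : ℝ) 1) :
    ‖((y : ℂ) * (1 - (y : ℂ) ^ 2)) ^ 2 / c ^ 2‖ ≤ 4 / 27 / ‖c‖ ^ 2 := by
  have e : ((y : ℂ) * (1 - (y : ℂ) ^ 2)) ^ 2 = (((y * (1 - y ^ 2)) ^ 2 : ℝ) : ℂ) := by push_cast; ring
  rw [norm_div, norm_pow c, e, Complex.norm_real, Real.norm_of_nonneg (sq_nonneg _)]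
  gcongr
  exact sq_cubic_le hy

theorem sq_sub_cubic_sq_ne_zero {c : ℂ} (hc : 4 / 27 < ‖c‖ ^ 2) {y : ℝ} (hy : y ∈ Icc (0 : ℝ) 1) :
    c ^ 2 - ((y : ℂ) * (1 - (y : ℂ) ^ 2)) ^ 2 ≠ 0 := by
  intro h
  have h1 : ‖c‖ ^ 2 = (y * (1 - y ^ 2)) ^ 2 := by
    rw [← norm_pow, sub_eq_zero.1 h]
    have e : ((y : ℂ) * (1 - (y : ℂ) ^ 2)) ^ 2 = (((y * (1 - y ^ 2)) ^ 2 : ℝ) : ℂ) := by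
      push_cast; ring
    rw [e, Complex.norm_real, Real.norm_of_nonneg (sq_nonneg _)]
  linarith [sq_cubic_le hy]

/-- The geometric series with ratio (p/c)², p = y(1 - y²), is integrated termwise; it is dominated
by |g| times a numerical geometric series of ratio (4/27)/|c|² < 1. -/
theorem hasSum_integral_mul_cubic_pow {g : ℝ → ℂ} (hg : IntervalIntegrable g volume 0 1) {c : ℂ}
    (hc : 4 / 27 < ‖c‖ ^ 2) :
    HasSum (fun j : ℕ => (∫ y in (0 : ℝ)..1, g y * ((y : ℂ) * (1 - (y : ℂ) ^ 2)) ^ (2 * j))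
        / (c ^ 2) ^ (j + 1))
      (∫ y in (0 : ℝ)..1, g y / (c ^ 2 - ((y : ℂ) * (1 - (y : ℂ) ^ 2)) ^ 2)) := by
  have hc0 : 0 < ‖c‖ ^ 2 := lt_trans (by norm_num) hc
  have hcn : c ^ 2 ≠ 0 := by
    rw [← norm_pos_iff, norm_pow]; exact hc0
  set r : ℝ := 4 / 27 / ‖c‖ ^ 2 with hr
  have hr0 : 0 ≤ r := by positivity
  have hr1 : r < 1 := (div_lt_one hc0).2 hc
  have hsub : ∀ t ∈ Ι (0 : ℝ) 1, t ∈ Icc (0 : ℝ) 1 := fun t ht => by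
    rw [uIoc_of_le zero_le_one] at ht; exact Ioc_subset_Icc_self ht
  have key := intervalIntegral.hasSum_integral_of_dominated_convergence (μ := volume)
    (a := 0) (b := 1)
    (F := fun (j : ℕ) (y : ℝ) =>
      g y * (1 / c ^ 2 * (((y : ℂ) * (1 - (y : ℂ) ^ 2)) ^ 2 / c ^ 2) ^ j))
    (f := fun y : ℝ => g y / (c ^ 2 - ((y : ℂ) * (1 - (y : ℂ) ^ 2)) ^ 2))
    (fun j y => ‖g y‖ * (‖1 / c ^ 2‖ * r ^ j)) ?_ ?_ ?_ ?_ ?_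
  · convert! key using 1
    ext j
    have haux : ∀ u p : ℂ,
        u * p ^ (2 * j) / (c ^ 2) ^ (j + 1) = u * (1 / c ^ 2 * (p ^ 2 / c ^ 2) ^ j) := fun u p => by
      rw [div_pow, ← pow_mul, pow_succ]; ring
    rw [← intervalIntegral.integral_div]
    congr 1; ext y
    exact haux _ _
  · intro j
    exact (hg.mul_continuousOn_zero_one (by fun_prop)).def'.aestronglyMeasurable
  · refine fun j => Eventually.of_forall fun t ht => ?_
    rw [norm_mul, norm_mul, norm_pow]
    gcongr
    exact norm_cubic_sq_lt hc (hsub t ht)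
  · exact Eventually.of_forall fun t _ =>
      ((summable_geometric_of_lt_one hr0 hr1).mul_left _).mul_left _
  · simp only [tsum_mul_left]
    exact hg.norm.mul_const _
  · refine Eventually.of_forall fun t ht => ?_
    have hlt := (norm_cubic_sq_lt hc (hsub t ht)).trans_lt hr1
    have h := ((hasSum_geometric_of_norm_lt_one hlt).mul_left (1 / c ^ 2)).mul_left (g t)
    convert! h using 1
    have := sq_sub_cubic_sq_ne_zero hc (hsub t ht)
    have e : 1 - ((t : ℂ) * (1 - (t : ℂ) ^ 2)) ^ 2 / c ^ 2
        = (c ^ 2 - ((t : ℂ) * (1 - (t : ℂ) ^ 2)) ^ 2) / c ^ 2 := by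
      rw [sub_div, div_self hcn]
    rw [e, inv_div, div_mul_div_comm, one_mul, mul_div_assoc', mul_comm (c ^ 2) (_ - _),
      mul_div_mul_right _ _ hcn]

/-- `∫₀¹ W(y) (q₀ + q₁ y² + q₂ y⁴) / (c² - y² (1 - y²)²) dy`. -/
noncomputable def genInt (W : ℝ → ℂ) (q₀ q₁ q₂ c : ℂ) : ℂ :=
  ∫ y in (0 : ℝ)..1, W y * (q₀ + q₁ * (y : ℂ) ^ 2 + q₂ * (y : ℂ) ^ 4)
    / (c ^ 2 - ((y : ℂ) * (1 - (y : ℂ) ^ 2)) ^ 2)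

theorem hasSum_moment {W : ℝ → ℂ} (hW : IntervalIntegrable W volume 0 1) (q₀ q₁ q₂ : ℂ) {c : ℂ}
    (hc : 4 / 27 < ‖c‖ ^ 2) :
    HasSum (fun j : ℕ => (q₀ * moment W (2 * j) (2 * j) + q₁ * moment W (2 * j) (2 * (j + 1))
      + q₂ * moment W (2 * j) (2 * (j + 2))) / (c ^ 2) ^ (j + 1)) (genInt W q₀ q₁ q₂ c) := by
  have h := hasSum_integral_mul_cubic_pow (intervalIntegrable_weight_mul hW
    (q := fun y => q₀ + q₁ * (y : ℂ) ^ 2 + q₂ * (y : ℂ) ^ 4) (by fun_prop)) hc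
  convert! h using 1
  ext j
  congr 1
  have hi : ∀ n, IntervalIntegrable (fun y : ℝ => W y * ((1 - (y : ℂ) ^ 2) ^ (2 * j) * (y : ℂ) ^ n))
    volume 0 1 := fun n => intervalIntegrable_weight_mul hW (by fun_prop)
  simp only [moment]
  rw [← intervalIntegral.integral_const_mul, ← intervalIntegral.integral_const_mul,
    ← intervalIntegral.integral_const_mul,
    ← intervalIntegral.integral_add ((hi _).const_mul _) ((hi _).const_mul _),
    ← intervalIntegral.integral_add (((hi _).const_mul _).add ((hi _).const_mul _))
      ((hi _).const_mul _)]
  congr 1; ext y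
  rw [mul_pow]; ring

theorem summand_eq (a d : ℕ → ℂ) (x : ℂ) (k : ℕ) :
    summand a d x k = a k * coeff k / d k / ((x * (1 - x ^ 2)) ^ 2) ^ k := by
  rw [summand, coeff, div_pow, pow_mul, pow_mul (x * (1 - x ^ 2))]
  norm_num
  simp only [div_eq_mul_inv, mul_inv]
  ring

/-! ### The moments in terms of the coefficients -/

theorem moment_one_right (m n : ℕ) :
    (2 * m + n + 3) * moment (fun _ => 1) m (n + 2) = (n + 1) * moment (fun _ => 1) m n := by
  have h1 := moment_one_rec m n
  rw [moment_succ_left intervalIntegrable_one] at h1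
  linear_combination -h1

section MomentValues

variable (j : ℕ)

/-- With k = j + 1 the exponents are (2k - 1, 2k), one step of the recurrence below the diagonal. -/
theorem moment_one_A :
    moment (fun _ => 1) (2 * j + 1) (2 * (j + 1)) = coeff (j + 1) / (4 * (j + 1)) := by
  have h1 := moment_one_rec (2 * j + 1) (2 * (j + 1))
  have h2 := moment_one_coeff (j + 1)
  rw [show 2 * (j + 1) = 2 * j + 1 + 1 by ring] at *
  rw [h2] at h1
  have e1 : (j + 1 : ℂ) ≠ 0 := by exact_mod_cast j.succ_ne_zero
  have e2 : (6 * j + 7 : ℂ) ≠ 0 := by exact_mod_cast (6 * j + 6).succ_ne_zero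
  push_cast at h1
  rw [show (6 * (j + 1) + 1 : ℂ) = 6 * j + 7 by ring] at h1
  rw [show (2 * (2 * j + 1) + (2 * j + 1 + 1) + 3 : ℂ) = 6 * j + 7 by ring,
    mul_div_cancel₀ _ e2] at h1
  rw [h1]; field_simp; ring

theorem moment_one_D : moment (fun _ => 1) (2 * (j + 1)) (2 * j) = coeff (j + 1) / (2 * j + 1) := by
  have h1 := moment_one_right (2 * (j + 1)) (2 * j)
  have h2 := moment_one_coeff (j + 1)
  rw [show 2 * j + 2 = 2 * (j + 1) by ring, h2] at h1
  have e1 := two_mul_add_one_ne_zero j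
  have e2 : (6 * j + 7 : ℂ) ≠ 0 := by exact_mod_cast (6 * j + 6).succ_ne_zero
  push_cast at h1
  rw [show (6 * (j + 1) + 1 : ℂ) = 6 * j + 7 by ring,
    show (2 * (2 * (j + 1)) + 2 * j + 3 : ℂ) = 6 * j + 7 by ring, mul_div_cancel₀ _ e2] at h1
  rw [h1]; field_simp

theorem moment_one_D' : moment (fun _ => 1) (2 * j) (2 * (j + 1))
    = coeff (j + 1) * (6 * j + 5) / (8 * (j + 1) * (2 * j + 1)) := by
  have h1 := moment_one_rec (2 * j) (2 * (j + 1))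
  rw [moment_one_A] at h1
  have e1 := two_mul_add_one_ne_zero j
  have e2 : (j + 1 : ℂ) ≠ 0 := by exact_mod_cast j.succ_ne_zero
  push_cast at h1
  rw [eq_div_iff (by simp [e1, e2])]
  field_simp at h1
  linear_combination -h1

theorem moment_one_D'' : moment (fun _ => 1) (2 * j) (2 * j)
    = 3 * (coeff (j + 1) * (6 * j + 5) / (8 * (j + 1) * (2 * j + 1))) := by
  have h1 := moment_one_right (2 * j) (2 * j)
  rw [show 2 * j + 2 = 2 * (j + 1) by ring, moment_one_D'] at h1
  have e1 := two_mul_add_one_ne_zero j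
  push_cast at h1
  refine mul_left_cancel₀ e1 ?_
  rw [← h1]; ring

theorem moment_one_C : moment (fun _ => 1) (2 * j) (2 * (j + 1)) = coeff j / (3 * (6 * j + 1)) := by
  have h1 := moment_one_right (2 * j) (2 * j)
  have h2 := moment_one_coeff j
  rw [show 2 * j + 2 = 2 * (j + 1) by ring, h2] at h1
  have e1 : (6 * j + 1 : ℂ) ≠ 0 := by exact_mod_cast (6 * j).succ_ne_zero
  have e2 := two_mul_add_one_ne_zero j
  push_cast at h1
  refine mul_left_cancel₀ (mul_ne_zero three_ne_zero e2) ?_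
  rw [mul_comm 3 (6 * j + 1 : ℂ), ← div_div]
  linear_combination h1

theorem moment_one_C' : moment (fun _ => 1) (2 * j) (2 * (j + 2))
    = coeff j * (2 * j + 3) / (3 * (6 * j + 1) * (6 * j + 5)) := by
  have h1 := moment_one_right (2 * j) (2 * (j + 1))
  rw [show 2 * (j + 1) + 2 = 2 * (j + 2) by ring, moment_one_C] at h1
  have e1 : (6 * j + 1 : ℂ) ≠ 0 := by exact_mod_cast (6 * j).succ_ne_zero
  have e2 : (6 * j + 5 : ℂ) ≠ 0 := by exact_mod_cast (6 * j + 4).succ_ne_zero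
  push_cast at h1
  rw [eq_div_iff (by simp [e1, e2])]
  rw [← mul_div_assoc, eq_div_iff (by simp [e1])] at h1
  linear_combination h1

end MomentValues

/-! ### The thirteen series as integrals -/

theorem seriesEq_one_of_moment {x : ℂ} (hx : 4 / 27 < ‖x * (1 - x ^ 2)‖ ^ 2)
    {W : ℝ → ℂ} (hW : IntervalIntegrable W volume 0 1) {a d : ℕ → ℂ} (q₀ q₁ q₂ : ℂ)
    (h : ∀ j : ℕ, q₀ * moment W (2 * j) (2 * j) + q₁ * moment W (2 * j) (2 * (j + 1))
      + q₂ * moment W (2 * j) (2 * (j + 2)) = a (j + 1) * coeff (j + 1) / d (j + 1)) :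
    SeriesEq 1 a d x (genInt W q₀ q₁ q₂ (x * (1 - x ^ 2))) := by
  have := hasSum_moment hW q₀ q₁ q₂ hx
  rw [SeriesEq]
  convert! this using 1
  ext j
  rw [summand_eq, h]

/-- The geometric expansion carries c^(-2(j+1)); a series that starts at k = 0 needs c^(-2j), hence
the factor c². When the series starts at 1 the shift k = j + 1 absorbs it. -/
theorem seriesEq_zero_of_moment {x : ℂ} (hx : 4 / 27 < ‖x * (1 - x ^ 2)‖ ^ 2)
    {W : ℝ → ℂ} (hW : IntervalIntegrable W volume 0 1) {a d : ℕ → ℂ} (q₀ q₁ q₂ : ℂ)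
    (h : ∀ j : ℕ, q₀ * moment W (2 * j) (2 * j) + q₁ * moment W (2 * j) (2 * (j + 1))
      + q₂ * moment W (2 * j) (2 * (j + 2)) = a j * coeff j / d j) :
    SeriesEq 0 a d x ((x * (1 - x ^ 2)) ^ 2 * genInt W q₀ q₁ q₂ (x * (1 - x ^ 2))) := by
  have hc : (x * (1 - x ^ 2)) ^ 2 ≠ 0 := by
    rw [← norm_pos_iff, norm_pow]; linarith
  have := (hasSum_moment hW q₀ q₁ q₂ hx).mul_left ((x * (1 - x ^ 2)) ^ 2)
  rw [SeriesEq]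
  convert! this using 1
  ext j
  rw [summand_eq, h, add_zero]
  generalize (x * (1 - x ^ 2)) ^ 2 = C at hc ⊢
  rw [pow_succ, mul_div_assoc', mul_comm C, mul_div_mul_right _ _ hc]

theorem moment_sub_sub {W : ℝ → ℂ} (hW : IntervalIntegrable W volume 0 1) (j : ℕ) :
    moment W (2 * j) (2 * (j + 1)) - moment W (2 * j) (2 * (j + 2))
      = moment W (2 * j + 1) (2 * (j + 1)) :=
  (moment_succ_left hW (2 * j) (2 * (j + 1))).symm

theorem moment_sub_sub' {W : ℝ → ℂ} (hW : IntervalIntegrable W volume 0 1) (j : ℕ) :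
    moment W (2 * j) (2 * j) - 2 * moment W (2 * j) (2 * (j + 1)) + moment W (2 * j) (2 * (j + 2))
      = moment W (2 * (j + 1)) (2 * j) := by
  have h1 := moment_succ_left hW (2 * j + 1) (2 * j)
  have h2 := moment_succ_left hW (2 * j) (2 * j)
  have h3 := moment_succ_left hW (2 * j) (2 * (j + 1))
  rw [show 2 * (j + 1) = 2 * j + 1 + 1 by ring, h1, h2]
  rw [show 2 * j + 1 + 1 = 2 * (j + 1) by ring, h3,
    show 2 * (j + 2) = 2 * (j + 1) + 2 by ring]
  ring

theorem seriesEq_A1 {x : ℂ} (hx : 4 / 27 < ‖x * (1 - x ^ 2)‖ ^ 2) :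
    SeriesEq 1 (fun _ => 1) (fun k => (k : ℂ)) x
      (genInt (fun _ => 1) 0 4 (-4) (x * (1 - x ^ 2))) := by
  refine seriesEq_one_of_moment hx intervalIntegrable_one _ _ _ fun j => ?_
  have h := moment_sub_sub intervalIntegrable_one j
  rw [moment_one_A] at h
  have e : (j + 1 : ℂ) ≠ 0 := by exact_mod_cast j.succ_ne_zero
  push_cast
  field_simp at h ⊢
  linear_combination h

theorem moment_wlog_A (j : ℕ) : 2 * moment wlog (2 * j + 1) (2 * (j + 1))
    = coeff (j + 1) / (4 * (j + 1)) * (-H (j + 1) + 2 * H (2 * (j + 1)) + H (3 * (j + 1))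
      - 2 * H (6 * (j + 1))) := by
  rw [moment_wlog_eq, moment_one_A, show 2 * j + 1 + (j + 1) + 1 = 3 * (j + 1) by ring, oddSum_eq,
    oddSum_eq, show 2 * (3 * (j + 1)) = 6 * (j + 1) by ring]
  ring

theorem seriesEq_A2 {x : ℂ} (hx : 4 / 27 < ‖x * (1 - x ^ 2)‖ ^ 2) :
    SeriesEq 1 (fun k => -H k + 2 * H (2 * k) + H (3 * k) - 2 * H (6 * k)) (fun k => (k : ℂ)) x
      (genInt wlog 0 8 (-8) (x * (1 - x ^ 2))) := by
  refine seriesEq_one_of_moment hx intervalIntegrable_wlog _ _ _ fun j => ?_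
  have h := moment_sub_sub intervalIntegrable_wlog j
  have h' := moment_wlog_A j
  have e : (j + 1 : ℂ) ≠ 0 := by exact_mod_cast j.succ_ne_zero
  push_cast
  rw [← h] at h'
  field_simp at h' ⊢
  linear_combination h'

/-- The moment has m = 2k - 1, and H_{2k-1} = H_{2k} - 1/(2k) accounts for the term -1/(2k). -/
theorem seriesEq_A3 {x : ℂ} (hx : 4 / 27 < ‖x * (1 - x ^ 2)‖ ^ 2) :
    SeriesEq 1 (fun k => H k - H (2 * k) - 1 / (2 * k) + 2 * Complex.log 2) (fun k => (k : ℂ)) x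
      (genInt well 0 4 (-4) (x * (1 - x ^ 2))) := by
  refine seriesEq_one_of_moment hx intervalIntegrable_well _ _ _ fun j => ?_
  have h := moment_sub_sub intervalIntegrable_well j
  have h2 : H (2 * (j + 1)) = H (2 * j + 1) + 1 / (2 * (j + 1)) := by
    rw [show 2 * (j + 1) = 2 * j + 1 + 1 by ring, H_succ]; push_cast; ring
  rw [moment_well_eq (2 * j + 1), moment_one_A, oddSum_eq, ← sub_eq_of_eq_add h2] at h
  have e : (j + 1 : ℂ) ≠ 0 := by exact_mod_cast j.succ_ne_zero
  push_cast at h ⊢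
  field_simp at h ⊢
  linear_combination h

/-- With p = y(1 - y²), the integrand besides tanh⁻¹ is the derivative of p^(2j+2)/(2j+2).
Integration by parts divides this by 1 - y², which leaves the moment of `moment_one_A` and produces
a second factor 1/k. -/
theorem integral_wath_mul_cubic_pow (j : ℕ) :
    ∫ y in (0 : ℝ)..1, wath y * ((y : ℂ) * (1 - y ^ 2) * (1 - 3 * y ^ 2))
      * ((y : ℂ) * (1 - (y : ℂ) ^ 2)) ^ (2 * j) = -(coeff (j + 1) / (8 * (j + 1) ^ 2)) := by
  have e : (j + 1 : ℂ) ≠ 0 := by exact_mod_cast j.succ_ne_zero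
  have h := integral_wath_mul_deriv (G := fun y => (y * (1 - y ^ 2)) ^ (2 * j + 2) / (2 * j + 2))
    (G' := fun y => y * (1 - y ^ 2) * (1 - 3 * y ^ 2) * (y * (1 - y ^ 2)) ^ (2 * j))
    (g := fun y => 1 * ((1 - (y : ℂ) ^ 2) ^ (2 * j + 1) * (y : ℂ) ^ (2 * (j + 1))) / (2 * j + 2))
    (fun y _ => by
      have h1 := (hasDerivAt_id (y : ℂ)).mul ((hasDerivAt_pow 2 (y : ℂ)).const_sub 1)
      have h2 := (h1.pow (2 * j + 2)).div_const (2 * j + 2 : ℂ)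
      convert! h2 using 1
      simp only [Pi.mul_apply, id, show 2 * j + 2 - 1 = 2 * j + 1 by lia, Nat.cast_add, Nat.cast_mul,
        Nat.cast_ofNat]
      rw [eq_div_iff (by convert! mul_ne_zero two_ne_zero e using 1; ring)]
      ring) (by fun_prop) (by fun_prop) (fun y _ => by rw [mul_pow]; ring)
  rw [intervalIntegral.integral_div] at h
  have h3 := moment_one_A j
  rw [moment] at h3
  rw [h3] at h
  simp only [mul_assoc] at h ⊢
  rw [h]
  field_simp
  ring

theorem seriesEq_A4 {x : ℂ} (hx : 4 / 27 < ‖x * (1 - x ^ 2)‖ ^ 2) :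
    SeriesEq 1 (fun k => 1 / (k : ℂ)) (fun k => (k : ℂ)) x
      (-8 * ∫ y in (0 : ℝ)..1, wath y * ((y : ℂ) * (1 - y ^ 2) * (1 - 3 * y ^ 2))
        / ((x * (1 - x ^ 2)) ^ 2 - ((y : ℂ) * (1 - (y : ℂ) ^ 2)) ^ 2)) := by
  have h := (hasSum_integral_mul_cubic_pow (intervalIntegrable_weight_mul intervalIntegrable_wath
    (q := fun y => (y : ℂ) * (1 - y ^ 2) * (1 - 3 * y ^ 2)) (by fun_prop)) hx).mul_left (-8)
  rw [SeriesEq]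
  convert! h using 1
  ext j
  have e : (j + 1 : ℂ) ≠ 0 := by exact_mod_cast j.succ_ne_zero
  rw [summand_eq, integral_wath_mul_cubic_pow, ← mul_div_assoc]
  congr 1
  push_cast
  field_simp

theorem six_mul_add_one_ne_zero (j : ℕ) : (6 * j + 1 : ℂ) ≠ 0 := by
  exact_mod_cast (6 * j).succ_ne_zero

theorem six_mul_add_five_ne_zero (j : ℕ) : (6 * j + 5 : ℂ) ≠ 0 := by
  exact_mod_cast (6 * j + 4).succ_ne_zero

theorem seriesEq_B1 {x : ℂ} (hx : 4 / 27 < ‖x * (1 - x ^ 2)‖ ^ 2) :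
    SeriesEq 0 (fun _ => 1) (fun k => 6 * (k : ℂ) + 1) x
      ((x * (1 - x ^ 2)) ^ 2 * genInt (fun _ => 1) 1 0 0 (x * (1 - x ^ 2))) := by
  refine seriesEq_zero_of_moment hx intervalIntegrable_one _ _ _ fun j => ?_
  rw [moment_one_coeff]
  ring

theorem seriesEq_B2 {x : ℂ} (hx : 4 / 27 < ‖x * (1 - x ^ 2)‖ ^ 2) :
    SeriesEq 0 (fun k => -H k + 2 * H (2 * k) + H (3 * k) - 2 * H (6 * k + 1))
      (fun k => 6 * (k : ℂ) + 1) x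
      ((x * (1 - x ^ 2)) ^ 2 * genInt wlog 2 0 0 (x * (1 - x ^ 2))) := by
  refine seriesEq_zero_of_moment hx intervalIntegrable_wlog _ _ _ fun j => ?_
  rw [moment_wlog_eq, moment_one_coeff, show 2 * j + j + 1 = 3 * j + 1 by ring, oddSum_eq, oddSum_eq,
    show 2 * (3 * j + 1) = 6 * j + 1 + 1 by ring, H_succ (6 * j + 1), H_succ (3 * j)]
  have e1 := six_mul_add_one_ne_zero j
  have e2 : (3 * j + 1 : ℂ) ≠ 0 := by exact_mod_cast (3 * j).succ_ne_zero
  -- The last terms of H_{6j+2} and H_{3j+1} cancel, since the latter enters with half the weight.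
  have e3 : 1 / ((6 * j + 1 : ℕ) + 1 : ℂ) = 1 / ((3 * j : ℕ) + 1 : ℂ) / 2 := by
    push_cast
    rw [div_div, show (6 * j + 1 + 1 : ℂ) = (3 * j + 1) * 2 by ring]
  rw [e3]
  ring

theorem seriesEq_B3 {x : ℂ} (hx : 4 / 27 < ‖x * (1 - x ^ 2)‖ ^ 2) :
    SeriesEq 0 (fun k => H k - H (2 * k) + 2 * Complex.log 2) (fun k => 6 * (k : ℂ) + 1) x
      ((x * (1 - x ^ 2)) ^ 2 * genInt well 1 0 0 (x * (1 - x ^ 2))) := by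
  refine seriesEq_zero_of_moment hx intervalIntegrable_well _ _ _ fun j => ?_
  rw [moment_well_eq, moment_one_coeff, oddSum_eq]
  ring

/-- The numerator 2 - 9y⁴ is chosen so that 2/(6j+1) - 3(2j+3)/((6j+1)(6j+5)) = 1/(6j+5). -/
theorem seriesEq_C1 {x : ℂ} (hx : 4 / 27 < ‖x * (1 - x ^ 2)‖ ^ 2) :
    SeriesEq 0 (fun _ => 1) (fun k => 6 * (k : ℂ) + 5) x
      ((x * (1 - x ^ 2)) ^ 2 * genInt (fun _ => 1) 2 0 (-9) (x * (1 - x ^ 2))) := by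
  refine seriesEq_zero_of_moment hx intervalIntegrable_one _ _ _ fun j => ?_
  rw [moment_one_coeff, moment_one_C']
  have e1 := six_mul_add_one_ne_zero j
  have e2 := six_mul_add_five_ne_zero j
  generalize hu : (6 * j + 1 : ℂ) = u at *
  generalize hv : (6 * j + 5 : ℂ) = v at *
  field_simp
  rw [← hu, ← hv]; ring

/-- With the numerator -1 + 9y² - 9y⁴ the unweighted moments again add up to `coeff j / (6j+5)`, and
the shifts of the odd sums combine to the single correction -6/(6k+1). -/
theorem seriesEq_C2_aux {x : ℂ} (hx : 4 / 27 < ‖x * (1 - x ^ 2)‖ ^ 2) :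
    SeriesEq 0 (fun k => H k - H (2 * k) + 2 * Complex.log 2 - 6 / (6 * k + 1))
      (fun k => 6 * (k : ℂ) + 5) x
      ((x * (1 - x ^ 2)) ^ 2 * genInt well (-1) 9 (-9) (x * (1 - x ^ 2))) := by
  refine seriesEq_zero_of_moment hx intervalIntegrable_well _ _ _ fun j => ?_
  have e1 := six_mul_add_one_ne_zero j
  have e2 := six_mul_add_five_ne_zero j
  have e3 := two_mul_add_one_ne_zero j
  have e4 : (2 * j + 3 : ℂ) ≠ 0 := by exact_mod_cast (2 * j + 2).succ_ne_zero
  rw [moment_well_eq, moment_well_eq, moment_well_eq, moment_one_coeff, moment_one_C, moment_one_C',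
    oddSum_succ (j + 1), oddSum_succ, oddSum_eq]
  push_cast
  rw [show (2 * (j + 1) + 1 : ℂ) = 2 * j + 3 by ring]
  generalize hu : (6 * j + 1 : ℂ) = u at *
  generalize hv : (6 * j + 5 : ℂ) = v at *
  generalize hs : (2 * j + 1 : ℂ) = s at *
  generalize ht : (2 * j + 3 : ℂ) = t at *
  field_simp
  have hj : (j : ℂ) = (s - 1) / 2 := by rw [← hs]; ring
  have hu' : u = 3 * s - 2 := by rw [← hu, ← hs]; ring
  have hv' : v = 3 * s + 2 := by rw [← hv, ← hs]; ring
  have ht' : t = s + 2 := by rw [← ht, ← hs]; ring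
  rw [hu', hv', ht']
  ring

theorem seriesEq_D1 {x : ℂ} (hx : 4 / 27 < ‖x * (1 - x ^ 2)‖ ^ 2) :
    SeriesEq 1 (fun _ => 1) (fun k => 2 * (k : ℂ) - 1) x
      (genInt (fun _ => 1) 1 (-2) 1 (x * (1 - x ^ 2))) := by
  refine seriesEq_one_of_moment hx intervalIntegrable_one _ _ _ fun j => ?_
  have h := moment_sub_sub' intervalIntegrable_one j
  rw [moment_one_D] at h
  push_cast
  rw [show (2 * (j + 1) - 1 : ℂ) = 2 * j + 1 by ring]
  linear_combination h

/-- Here the exponent of y is 2(k - 1), and `oddSum (k - 1)` differs from `oddSum k` by 1/(2k - 1);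
this is the extra term in the coefficient. -/
theorem seriesEq_D2 {x : ℂ} (hx : 4 / 27 < ‖x * (1 - x ^ 2)‖ ^ 2) :
    SeriesEq 1 (fun k => -H k + 2 * H (2 * k) + H (3 * k) - 2 * H (6 * k) - 2 / (2 * k - 1))
      (fun k => 2 * (k : ℂ) - 1) x (genInt wlog 2 (-4) 2 (x * (1 - x ^ 2))) := by
  refine seriesEq_one_of_moment hx intervalIntegrable_wlog _ _ _ fun j => ?_
  have h := moment_sub_sub' intervalIntegrable_wlog j
  have h2 := oddSum_succ j
  rw [moment_wlog_eq (2 * (j + 1)), moment_one_D, show 2 * (j + 1) + j + 1 = 3 * (j + 1) by ring,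
    oddSum_eq (3 * (j + 1)), show 2 * (3 * (j + 1)) = 6 * (j + 1) by ring, ← sub_eq_of_eq_add h2,
    oddSum_eq (j + 1)] at h
  push_cast
  rw [show (2 * (j + 1) - 1 : ℂ) = 2 * j + 1 by ring]
  linear_combination 2 * h

theorem seriesEq_D3 {x : ℂ} (hx : 4 / 27 < ‖x * (1 - x ^ 2)‖ ^ 2) :
    SeriesEq 1 (fun k => H k - H (2 * k) + 2 / (2 * k - 1) + 2 * Complex.log 2)
      (fun k => 2 * (k : ℂ) - 1) x (genInt well 1 (-2) 1 (x * (1 - x ^ 2))) := by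
  refine seriesEq_one_of_moment hx intervalIntegrable_well _ _ _ fun j => ?_
  have h := moment_sub_sub' intervalIntegrable_well j
  have h2 := oddSum_succ j
  rw [moment_well_eq (2 * (j + 1)), moment_one_D, ← sub_eq_of_eq_add h2, oddSum_eq (j + 1)] at h
  push_cast
  rw [show (2 * (j + 1) - 1 : ℂ) = 2 * j + 1 by ring]
  linear_combination h

/-- For the numerator 3y² - 1 the unweighted moments cancel, so in the logarithmic ones all harmonic
sums drop out and only a rational term remains. Over 2k - 1 it is (6k - 1)/(4k(2k - 1)²), that is,
1/(2k - 1)² plus multiples of 1/(2k - 1) and 1/k. -/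
theorem seriesEq_D4_aux {x : ℂ} (hx : 4 / 27 < ‖x * (1 - x ^ 2)‖ ^ 2) :
    SeriesEq 1 (fun k => 1 / (2 * (k : ℂ) - 1) + 1 / 2 - (2 * k - 1) / (4 * k))
      (fun k => 2 * (k : ℂ) - 1) x (genInt wlog (-1) 3 0 (x * (1 - x ^ 2))) := by
  refine seriesEq_one_of_moment hx intervalIntegrable_wlog _ _ _ fun j => ?_
  have h3 : oddSum (2 * j + (j + 1) + 1) = oddSum (2 * j + j + 1) + 1 / (6 * j + 3) := by
    rw [show 2 * j + (j + 1) + 1 = 2 * j + j + 1 + 1 by ring, oddSum_succ]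
    push_cast; ring
  rw [moment_wlog_eq, moment_wlog_eq, moment_one_D', moment_one_D'', h3, oddSum_succ j]
  have e1 := two_mul_add_one_ne_zero j
  have e2 : (j + 1 : ℂ) ≠ 0 := by exact_mod_cast j.succ_ne_zero
  push_cast
  rw [show (2 * (j + 1) - 1 : ℂ) = 2 * j + 1 by ring,
    show (6 * j + 3 : ℂ) = 3 * (2 * j + 1) by ring]
  generalize hs : (2 * j + 1 : ℂ) = s at *
  generalize ht : (j + 1 : ℂ) = t at *
  have hj : (j : ℂ) = t - 1 := by rw [← ht]; ring
  have hs' : s = 2 * t - 1 := by rw [← hs, ← ht]; ring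
  field_simp
  rw [hj, hs']
  ring

/-! ### The region and the roots of `y (1 - y²) = x (1 - x²)` -/

theorem mem_region_iff {x : ℂ} : x ∈ region ↔ 4 / 27 < ‖x * (1 - x ^ 2)‖ ^ 2 := by
  have h3 : (0 : ℝ) < Real.sqrt 3 := Real.sqrt_pos.2 (by norm_num)
  have h : (2 / (3 * Real.sqrt 3)) ^ 2 = 4 / 27 := by
    rw [div_pow, mul_pow, Real.sq_sqrt (by norm_num)]; norm_num
  rw [← h, sq_lt_sq₀ (by positivity) (norm_nonneg _)]
  rfl

/-- If 1/w lay on a cut, w would be real in [-1,1], contradicting `sq_cubic_le`. Only the modulus of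
w(1 - w²) enters, so the lemma serves all three roots. -/
theorem inv_mem_cutPlane {w : ℂ} (hw : 4 / 27 < ‖w * (1 - w ^ 2)‖ ^ 2) : 1 / w ∈ cutPlane := by
  have key : ∀ t : ℝ, t ∈ Icc (-1 : ℝ) 1 → w ≠ (t : ℂ) := by
    rintro t ht rfl
    have e : (t : ℂ) * (1 - (t : ℂ) ^ 2) = ((t * (1 - t ^ 2) : ℝ) : ℂ) := by push_cast; ring
    rw [e, Complex.norm_real, Real.norm_eq_abs, sq_abs] at hw
    rcases le_total 0 t with h | h
    · linarith [sq_cubic_le ⟨h, ht.2⟩]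
    · have := sq_cubic_le (y := -t) ⟨by linarith, by linarith [ht.1]⟩
      rw [neg_mul, neg_sq, neg_sq] at this
      linarith
  have aux : ∀ ε : ℝ, ε ^ 2 = 1 → 1 + ε * (1 / w) ∈ slitPlane := by
    intro ε hε
    by_contra h
    rw [Complex.mem_slitPlane_iff, not_or, not_lt, not_not] at h
    set v : ℂ := 1 / w with hv
    have hre : ε * v.re ≤ -1 := by
      have := h.1; simp at this; linarith
    have him : v.im = 0 := by
      have h2 := h.2
      simp at h2
      rcases h2 with h2 | h2
      · rw [h2] at hε; norm_num at hε
      · exact h2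
    have hvr : v = (v.re : ℂ) := by
      apply Complex.ext <;> simp [him]
    refine key (v.re)⁻¹ ?_ ?_
    · have hsq : 1 ≤ v.re ^ 2 := by nlinarith
      have habs : 1 ≤ |v.re| := by
        rwa [← one_le_sq_iff_one_le_abs]
      rw [mem_Icc, ← abs_le, abs_inv]
      exact inv_le_one_of_one_le₀ habs
    · push_cast
      rw [← hvr, hv]; simp
  refine ⟨?_, ?_⟩
  · simpa using aux 1 (by norm_num)
  · have := aux (-1) (by norm_num)
    push_cast at this
    rw [sub_eq_add_neg]
    simpa using this

theorem rt_sq (x : ℂ) : rt x ^ 2 = 3 * x ^ 2 - 4 := by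
  have := Complex.cpow_nat_inv_pow (3 * x ^ 2 - 4) two_ne_zero
  rw [rt, one_div]
  exact_mod_cast this

/-- `σ_{0,0}`. -/
noncomputable def rootA (x : ℂ) : ℂ := (x + Complex.I * rt x) / 2

/-- `σ_{0,1}`. -/
noncomputable def rootB (x : ℂ) : ℂ := (x - Complex.I * rt x) / 2

theorem rootA_mul_rootB (x : ℂ) : rootA x * rootB x = x ^ 2 - 1 := by
  have h := rt_sq x
  rw [rootA, rootB]
  linear_combination (-(Complex.I) ^ 2 / 4) * h - ((3 * x ^ 2 - 4) / 4) * Complex.I_sq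

theorem rootA_add_rootB (x : ℂ) : rootA x + rootB x = x := by
  rw [rootA, rootB]; ring

theorem rootA_sub_rootB (x : ℂ) : rootA x - rootB x = Complex.I * rt x := by
  rw [rootA, rootB]; ring

/-- By Vieta x, -a, -b are the three roots of y(1 - y²) = c, where c = x(1 - x²). -/
theorem cubic_eq_neg_of_add_of_mul {a b x : ℂ} (h1 : a + b = x) (h2 : a * b = x ^ 2 - 1) :
    a * (1 - a ^ 2) = -(x * (1 - x ^ 2)) := by
  have hb : b = x - a := by rw [← h1]; ring
  subst hb
  linear_combination (a + x) * h2

theorem cubic_rootA (x : ℂ) : rootA x * (1 - rootA x ^ 2) = -(x * (1 - x ^ 2)) :=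
  cubic_eq_neg_of_add_of_mul (rootA_add_rootB x) (rootA_mul_rootB x)

theorem cubic_rootB (x : ℂ) : rootB x * (1 - rootB x ^ 2) = -(x * (1 - x ^ 2)) :=
  cubic_eq_neg_of_add_of_mul ((add_comm _ _).trans (rootA_add_rootB x))
    ((mul_comm _ _).trans (rootA_mul_rootB x))

section Region

variable {x : ℂ}

theorem inv_mem_cutPlane_of_mem_region (hx : x ∈ region) : 1 / x ∈ cutPlane :=
  inv_mem_cutPlane (mem_region_iff.1 hx)

theorem inv_rootA_mem_cutPlane (hx : x ∈ region) : 1 / rootA x ∈ cutPlane :=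
  inv_mem_cutPlane (by rw [cubic_rootA, norm_neg]; exact mem_region_iff.1 hx)

theorem inv_rootB_mem_cutPlane (hx : x ∈ region) : 1 / rootB x ∈ cutPlane :=
  inv_mem_cutPlane (by rw [cubic_rootB, norm_neg]; exact mem_region_iff.1 hx)

theorem cubic_ne_zero (hx : x ∈ region) : x * (1 - x ^ 2) ≠ 0 := by
  intro h
  have := mem_region_iff.1 hx
  rw [h] at this; norm_num at this

theorem ne_zero_of_mem_region (hx : x ∈ region) : x ≠ 0 := left_ne_zero_of_mul (cubic_ne_zero hx)

theorem one_sub_sq_ne_zero (hx : x ∈ region) : 1 - x ^ 2 ≠ 0 := right_ne_zero_of_mul (cubic_ne_zero hx)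

theorem rootA_ne_zero (hx : x ∈ region) : rootA x ≠ 0 := by
  intro h
  have := cubic_rootA x
  rw [h] at this
  exact cubic_ne_zero hx (by linear_combination this)

theorem rootB_ne_zero (hx : x ∈ region) : rootB x ≠ 0 := by
  intro h
  have := cubic_rootB x
  rw [h] at this
  exact cubic_ne_zero hx (by linear_combination this)

theorem cubic_sq_ne (hx : x ∈ region) : (x * (1 - x ^ 2)) ^ 2 ≠ 4 / 27 := by
  intro h
  have h1 := mem_region_iff.1 hx
  rw [← norm_pow, h] at h1
  norm_num at h1

theorem one_sub_three_mul_sq_ne_zero (hx : x ∈ region) : 1 - 3 * x ^ 2 ≠ 0 := by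
  intro h
  apply cubic_sq_ne hx
  have h1 : x ^ 2 = 1 / 3 := by linear_combination -h / 3
  rw [mul_pow, h1]; norm_num

theorem rt_ne_zero (hx : x ∈ region) : rt x ≠ 0 := by
  intro h
  apply cubic_sq_ne hx
  have h1 := rt_sq x
  rw [h] at h1
  have h2 : x ^ 2 = 4 / 3 := by linear_combination -h1 / 3
  rw [mul_pow, h2]; norm_num

/-! ### Partial fractions over the three roots -/

theorem kernel_eq {w : ℂ} (hw : w ≠ 0) (Y : ℂ) :
    2 * (1 / w) / (1 - (1 / w) ^ 2 * Y) = 2 * w / (w ^ 2 - Y) := by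
  have e : 1 - (1 / w) ^ 2 * Y = (w ^ 2 - Y) / w ^ 2 := by field_simp
  rw [e, div_div_eq_mul_div]
  congr 1
  field_simp

theorem sq_sub_ofReal_sq_ne_zero {w : ℂ} (hw : w ≠ 0) (h : 1 / w ∈ cutPlane) {y : ℝ}
    (hy : y ∈ Icc (0 : ℝ) 1) : w ^ 2 - (y : ℂ) ^ 2 ≠ 0 := by
  have := one_sub_sq_mul_sq_ne_zero h y hy
  intro h0
  apply this
  have e : 1 - (1 / w) ^ 2 * (y : ℂ) ^ 2 = (w ^ 2 - (y : ℂ) ^ 2) / w ^ 2 := by field_simp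
  rw [e, h0, zero_div]

theorem intervalIntegrable_kernel {W : ℝ → ℂ} (hW : IntervalIntegrable W volume 0 1) {z : ℂ}
    (hz : z ∈ cutPlane) :
    IntervalIntegrable (fun y : ℝ => W y * (2 * z / (1 - z ^ 2 * (y : ℂ) ^ 2))) volume 0 1 :=
  hW.mul_continuousOn_zero_one
    (ContinuousOn.div (by fun_prop) (by fun_prop) (one_sub_sq_mul_sq_ne_zero hz))

/-- The partial fraction decomposition of an even rational kernel with poles at the roots. -/
theorem partialFraction {a b x r : ℂ} (h1 : a + b = x) (h2 : a * b = x ^ 2 - 1)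
    (h3 : a - b = Complex.I * r) (hr : r ≠ 0) (q₀ q₁ q₂ Y : ℂ) (hx : x ^ 2 - Y ≠ 0)
    (ha : a ^ 2 - Y ≠ 0) (hb : b ^ 2 - Y ≠ 0) (hc : x * (1 - x ^ 2) ≠ 0) (h13 : 1 - 3 * x ^ 2 ≠ 0) :
    (q₀ + q₁ * Y + q₂ * Y ^ 2) / ((x * (1 - x ^ 2)) ^ 2 - Y * (1 - Y) ^ 2)
      = 1 / (2 * (x * (1 - x ^ 2)) * (1 - 3 * x ^ 2)) *
        ((q₀ + q₁ * x ^ 2 + q₂ * x ^ 4) * (2 * x / (x ^ 2 - Y))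
        - (-1 / 2 * q₀ + (x ^ 2 - 1 / 2) * q₁ + (3 * x ^ 2 - 1 - x ^ 4) / 2 * q₂)
          * (2 * a / (a ^ 2 - Y) + 2 * b / (b ^ 2 - Y))
        + Complex.I / r * (3 * x / 2 * q₀ + x / 2 * q₁ + (-x + 5 * x ^ 3 - 3 * x ^ 5) / 2 * q₂)
          * (2 * a / (a ^ 2 - Y) - 2 * b / (b ^ 2 - Y))) := by
  set N : ℂ := (x ^ 2 - 1) ^ 2 - Y * (2 - x ^ 2) + Y ^ 2 with hN
  have hNe : (a ^ 2 - Y) * (b ^ 2 - Y) = N := by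
    rw [hN]
    linear_combination (a * b + x ^ 2 - 1 + 2 * Y) * h2 - Y * (a + b + x) * h1
  have hN0 : N ≠ 0 := hNe ▸ mul_ne_zero ha hb
  have s1 : 2 * a / (a ^ 2 - Y) + 2 * b / (b ^ 2 - Y) = 2 * x * (x ^ 2 - 1 - Y) / N := by
    rw [div_add_div _ _ ha hb, hNe, ← h1]
    congr 1
    have : (x ^ 2 - 1) = a * b := h2.symm
    rw [h1, this, ← h1]; ring
  have s2 : 2 * a / (a ^ 2 - Y) - 2 * b / (b ^ 2 - Y)
      = -2 * (Complex.I * r) * (x ^ 2 - 1 + Y) / N := by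
    rw [div_sub_div _ _ ha hb, hNe, ← h3, ← h2]
    congr 1
    ring
  have s3 : ∀ A : ℂ, Complex.I / r * A * (-2 * (Complex.I * r) * (x ^ 2 - 1 + Y) / N)
      = A * (2 * (x ^ 2 - 1 + Y)) / N := fun A => by
    have : Complex.I / r * A * (-2 * (Complex.I * r) * (x ^ 2 - 1 + Y) / N)
      = -(Complex.I ^ 2) * (r / r) * A * (2 * (x ^ 2 - 1 + Y)) / N := by ring
    rw [this, div_self hr, Complex.I_sq]; ring
  have hD : (x * (1 - x ^ 2)) ^ 2 - Y * (1 - Y) ^ 2 = (x ^ 2 - Y) * N := by rw [hN]; ring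
  rw [s1, s2, s3, hD]
  have h1x := right_ne_zero_of_mul hc
  have hx0 := left_ne_zero_of_mul hc
  rw [← mul_div_assoc, ← mul_div_assoc, div_sub_div _ _ hx hN0, div_add_div _ _ (mul_ne_zero hx hN0)
    hN0, div_mul_div_comm, div_eq_div_iff (mul_ne_zero hx hN0)
    (mul_ne_zero (mul_ne_zero (mul_ne_zero two_ne_zero hc) h13)
      (mul_ne_zero (mul_ne_zero hx hN0) hN0))]
  -- The residue at w is Q(w²)/(2w(1 - w²)(1 - 3w²)), with w(1 - w²) equal to c at x and to -c at a,
  -- b. The coefficients for a and b are the half-sum and half-difference of (1 - 3x²)Q(w²)/(1 -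
  -- 3w²) at these two roots; once the terms are paired, r cancels and a polynomial identity in x
  -- and Y is left.
  have main : (q₀ + q₁ * Y + q₂ * Y ^ 2) * (2 * (x * (1 - x ^ 2)) * (1 - 3 * x ^ 2))
      = (q₀ + q₁ * x ^ 2 + q₂ * x ^ 4) * (2 * x) * N
        - (x ^ 2 - Y) * ((-1 / 2 * q₀ + (x ^ 2 - 1 / 2) * q₁ + (3 * x ^ 2 - 1 - x ^ 4) / 2 * q₂)
          * (2 * x * (x ^ 2 - 1 - Y)))
        + (x ^ 2 - Y) * ((3 * x / 2 * q₀ + x / 2 * q₁ + (-x + 5 * x ^ 3 - 3 * x ^ 5) / 2 * q₂)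
          * (2 * (x ^ 2 - 1 + Y))) := by
    rw [hN]; ring
  linear_combination ((x ^ 2 - Y) * N * N) * main

theorem genInt_eq (hx : x ∈ region) {W : ℝ → ℂ} (hW : IntervalIntegrable W volume 0 1)
    (q₀ q₁ q₂ : ℂ) :
    genInt W q₀ q₁ q₂ (x * (1 - x ^ 2))
      = 1 / (2 * (x * (1 - x ^ 2)) * (1 - 3 * x ^ 2)) *
        ((q₀ + q₁ * x ^ 2 + q₂ * x ^ 4) * kernelInt W (1 / x)
        - (-1 / 2 * q₀ + (x ^ 2 - 1 / 2) * q₁ + (3 * x ^ 2 - 1 - x ^ 4) / 2 * q₂)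
          * (kernelInt W (1 / rootA x) + kernelInt W (1 / rootB x))
        + Complex.I / rt x * (3 * x / 2 * q₀ + x / 2 * q₁ + (-x + 5 * x ^ 3 - 3 * x ^ 5) / 2 * q₂)
          * (kernelInt W (1 / rootA x) - kernelInt W (1 / rootB x))) := by
  have mx := inv_mem_cutPlane_of_mem_region hx
  have ma := inv_rootA_mem_cutPlane hx
  have mb := inv_rootB_mem_cutPlane hx
  have ix := intervalIntegrable_kernel hW mx
  have ia := intervalIntegrable_kernel hW ma
  have ib := intervalIntegrable_kernel hW mb
  simp only [kernelInt, genInt]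
  rw [← intervalIntegral.integral_add ia ib, ← intervalIntegral.integral_sub ia ib,
    ← intervalIntegral.integral_const_mul, ← intervalIntegral.integral_const_mul,
    ← intervalIntegral.integral_const_mul,
    ← intervalIntegral.integral_sub (ix.const_mul _) ((ia.add ib).const_mul _),
    ← intervalIntegral.integral_add ((ix.const_mul _).sub ((ia.add ib).const_mul _))
      ((ia.sub ib).const_mul _), ← intervalIntegral.integral_const_mul]
  refine intervalIntegral.integral_congr fun y hy => ?_
  rw [uIcc_of_le zero_le_one] at hy
  have hp := partialFraction (rootA_add_rootB x) (rootA_mul_rootB x) (rootA_sub_rootB x)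
    (rt_ne_zero hx) q₀ q₁ q₂ ((y : ℂ) ^ 2)
    (sq_sub_ofReal_sq_ne_zero (ne_zero_of_mem_region hx) mx hy)
    (sq_sub_ofReal_sq_ne_zero (rootA_ne_zero hx) ma hy)
    (sq_sub_ofReal_sq_ne_zero (rootB_ne_zero hx) mb hy) (cubic_ne_zero hx)
    (one_sub_three_mul_sq_ne_zero hx)
  simp only [kernel_eq (ne_zero_of_mem_region hx), kernel_eq (rootA_ne_zero hx),
    kernel_eq (rootB_ne_zero hx)]
  have e1 : ((y : ℂ) * (1 - (y : ℂ) ^ 2)) ^ 2 = (y : ℂ) ^ 2 * (1 - (y : ℂ) ^ 2) ^ 2 := by ring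
  have e2 : (y : ℂ) ^ 4 = ((y : ℂ) ^ 2) ^ 2 := by ring
  rw [mul_div_assoc, e1, e2, hp]
  ring

/-- The inverse hyperbolic tangents of the reciprocal roots add up to zero. -/
theorem arctanh_add_arctanh (hx : x ∈ region) :
    arctanh (1 / rootA x) + arctanh (1 / rootB x) = arctanh (1 / x) := by
  have hc := mem_region_iff.1 hx
  have hc0 := cubic_ne_zero hx
  set c := x * (1 - x ^ 2) with hcdef
  -- The numerator 1 - 3y² is p' for p = y(1 - y²). In the partial fractions the antisymmetric
  -- coefficient is 0 and the other two are ±(1 - 3x²), so the vanishing of this integral is the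
  -- claimed relation.
  have h := genInt_eq hx intervalIntegrable_one 1 (-3) 0
  rw [kernelInt_one (inv_mem_cutPlane_of_mem_region hx), kernelInt_one (inv_rootA_mem_cutPlane hx),
    kernelInt_one (inv_rootB_mem_cutPlane hx)] at h
  have hslit : ∀ ε : ℂ, ε ^ 2 = 1 → ∀ y ∈ Icc (0 : ℝ) 1,
      1 + ε * ((y : ℂ) * (1 - (y : ℂ) ^ 2)) / c ∈ slitPlane := fun ε hε y hy => by
    apply Complex.mem_slitPlane_of_norm_lt_one
    have h1 := norm_cubic_sq_lt hc hy
    have h2 : 4 / 27 / ‖c‖ ^ 2 < 1 := (div_lt_one (lt_trans (by norm_num) hc)).2 hc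
    have h3 : ‖ε * ((y : ℂ) * (1 - (y : ℂ) ^ 2)) / c‖ ^ 2 < 1 := by
      rw [← norm_pow, div_pow, mul_pow, hε, one_mul]
      exact h1.trans_lt h2
    nlinarith [norm_nonneg (ε * ((y : ℂ) * (1 - (y : ℂ) ^ 2)) / c)]
  -- The primitive (log(1 + p/c) - log(1 - p/c))/(2c) is legitimate since |p/c| < 1, and it is zero
  -- at both endpoints because p(0) = p(1) = 0.
  have h0 : genInt (fun _ => 1) 1 (-3) 0 c = 0 := by
    have := intervalIntegral.integral_eq_sub_of_hasDerivAt (a := 0) (b := 1)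
      (f := fun y : ℝ => (Complex.log (1 + 1 * ((y : ℂ) * (1 - (y : ℂ) ^ 2)) / c)
        - Complex.log (1 + (-1) * ((y : ℂ) * (1 - (y : ℂ) ^ 2)) / c)) / (2 * c))
      (f' := fun y : ℝ => 1 * (1 + (-3) * (y : ℂ) ^ 2 + 0 * (y : ℂ) ^ 4)
        / (c ^ 2 - ((y : ℂ) * (1 - (y : ℂ) ^ 2)) ^ 2))
      (fun y hy => by
        rw [uIcc_of_le zero_le_one] at hy
        have d1 : ∀ ε : ℂ, HasDerivAt (fun y : ℂ => 1 + ε * (y * (1 - y ^ 2)) / c)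
            (ε * (1 - 3 * (y : ℂ) ^ 2) / c) y := fun ε => by
          have := (((hasDerivAt_id (y : ℂ)).mul
            ((hasDerivAt_pow 2 (y : ℂ)).const_sub 1)).const_mul ε).div_const c
          convert! this.const_add 1 using 1
          simp; ring
        have m1 := hslit 1 (by norm_num) y hy
        have m2 := hslit (-1) (by norm_num) y hy
        have := ((((d1 1).clog m1).sub ((d1 (-1)).clog m2)).div_const (2 * c)).comp_ofReal
        convert! this using 1
        have n1 := Complex.slitPlane_ne_zero m1
        have n2 := Complex.slitPlane_ne_zero m2
        have n3 := sq_sub_cubic_sq_ne_zero hc hy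
        generalize (y : ℂ) * (1 - (y : ℂ) ^ 2) = p at *
        have e1 : 1 + 1 * p / c = (c + p) / c := by field_simp
        have e2 : 1 + -1 * p / c = (c - p) / c := by field_simp; ring
        rw [e1] at n1
        rw [e2] at n2
        have n1' : c + p ≠ 0 := fun h => n1 (by rw [h, zero_div])
        have n2' : c - p ≠ 0 := fun h => n2 (by rw [h, zero_div])
        have e3 : c ^ 2 - p ^ 2 = (c + p) * (c - p) := by ring
        rw [e1, e2, e3]
        field_simp
        ring)
      (ContinuousOn.div (by fun_prop) (by fun_prop)
        fun y hy => sq_sub_cubic_sq_ne_zero hc hy).intervalIntegrable_zero_one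
    rw [genInt, this]
    simp
  rw [h0] at h
  have h13 := one_sub_three_mul_sq_ne_zero hx
  rcases mul_eq_zero.1 h.symm with h | h
  · exfalso
    exact one_div_ne_zero (mul_ne_zero (mul_ne_zero two_ne_zero hc0) h13) h
  · refine mul_left_cancel₀ h13 ?_
    linear_combination -h / 2

end Region

/-! ### The special functions in terms of the kernel integrals -/

/-- The four σ are ±a and ±b, so the signed double sums pair the values at w and -w into kernel
integrals. -/
theorem sigma_eq (x : ℂ) : sigma 0 0 x = rootA x ∧ sigma 0 1 x = rootB x ∧
    sigma 1 0 x = -rootB x ∧ sigma 1 1 x = -rootA x := by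
  refine ⟨?_, ?_, ?_, ?_⟩ <;> simp only [sigma, rootA, rootB] <;> ring

theorem kernelInt_wlog_inv {w : ℂ} (hw : 1 / w ∈ cutPlane) :
    kernelInt wlog (1 / w) = Li2 (-1 / w) - Li2 (1 / w) := by
  rw [kernelInt_wlog hw, neg_div]

theorem kernelInt_well_inv {w : ℂ} (hw0 : w ≠ 0) (hw : 1 / w ∈ cutPlane) :
    kernelInt well (1 / w) = beta w := by
  have e1 : (1 / w - 1) / (1 / w + 1) = (1 - w) / (1 + w) := by
    rw [← div_div_div_cancel_right₀ hw0 (1 - w) (1 + w), sub_div 1 w w, add_div 1 w w, div_self hw0]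
  have e2 : (1 / w + 1) / (1 / w - 1) = (1 + w) / (1 - w) := by
    rw [← div_div_div_cancel_right₀ hw0 (1 + w) (1 - w), sub_div 1 w w, add_div 1 w w, div_self hw0]
  rw [kernelInt_well_eq_betaInv hw, betaInv, beta, e1, e2]

theorem frakL_eq {x : ℂ} (hx : x ∈ region) :
    frakL x = 2 * kernelInt wlog (1 / x)
      + (kernelInt wlog (1 / rootA x) + kernelInt wlog (1 / rootB x)) := by
  obtain ⟨h1, h2, h3, h4⟩ := sigma_eq x
  rw [kernelInt_wlog_inv (inv_mem_cutPlane_of_mem_region hx),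
    kernelInt_wlog_inv (inv_rootA_mem_cutPlane hx), kernelInt_wlog_inv (inv_rootB_mem_cutPlane hx)]
  simp only [frakL, Finset.sum_range_succ, Finset.sum_range_zero, h1, h2, h3, h4, one_div_neg_eq_neg_one_div, neg_div]
  ring

theorem frakM_eq {x : ℂ} (hx : x ∈ region) :
    frakM x = -(kernelInt wlog (1 / rootA x) - kernelInt wlog (1 / rootB x)) := by
  obtain ⟨h1, h2, h3, h4⟩ := sigma_eq x
  rw [kernelInt_wlog_inv (inv_rootA_mem_cutPlane hx), kernelInt_wlog_inv (inv_rootB_mem_cutPlane hx)]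
  simp only [frakM, Finset.sum_range_succ, Finset.sum_range_zero, h1, h2, h3, h4, one_div_neg_eq_neg_one_div, neg_div]
  ring

theorem frakl_eq {x : ℂ} (hx : x ∈ region) :
    frakl x = 2 * kernelInt well (1 / x)
      + (kernelInt well (1 / rootA x) + kernelInt well (1 / rootB x)) := by
  obtain ⟨h1, h2, h3, h4⟩ := sigma_eq x
  rw [kernelInt_well_inv (ne_zero_of_mem_region hx) (inv_mem_cutPlane_of_mem_region hx),
    kernelInt_well_inv (rootA_ne_zero hx) (inv_rootA_mem_cutPlane hx),
    kernelInt_well_inv (rootB_ne_zero hx) (inv_rootB_mem_cutPlane hx)]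
  simp only [frakl, beta, Finset.sum_range_succ, Finset.sum_range_zero, h1, h2, h3, h4, one_div_neg_eq_neg_one_div,
    sub_neg_eq_add, ← sub_eq_add_neg]
  ring

theorem frakm_eq {x : ℂ} (hx : x ∈ region) :
    frakm x = kernelInt well (1 / rootA x) - kernelInt well (1 / rootB x) := by
  obtain ⟨h1, h2, h3, h4⟩ := sigma_eq x
  rw [kernelInt_well_inv (rootA_ne_zero hx) (inv_rootA_mem_cutPlane hx),
    kernelInt_well_inv (rootB_ne_zero hx) (inv_rootB_mem_cutPlane hx)]
  simp only [frakm, beta, Finset.sum_range_succ, Finset.sum_range_zero, h1, h2, h3, h4, one_div_neg_eq_neg_one_div,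
    sub_neg_eq_add, ← sub_eq_add_neg]
  ring

/-! ### Holomorphy -/

/-- Near a point of the region 3x² - 4 has a holomorphic square root s, and `rt` equals s or -s at
each point separately. An even expression cannot see the sign, so the jump of the principal root is
harmless. -/
theorem differentiableAt_of_even_in_rt {Ψ : ℂ → ℂ → ℂ} (heven : ∀ x s, Ψ x (-s) = Ψ x s) {x₀ : ℂ}
    (hx₀ : x₀ ∈ region)
    (h : ∀ s : ℂ → ℂ, DifferentiableAt ℂ s x₀ → s x₀ = rt x₀ →
      DifferentiableAt ℂ (fun x => Ψ x (s x)) x₀) :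
    DifferentiableAt ℂ (fun x => Ψ x (rt x)) x₀ := by
  have hr := rt_ne_zero hx₀
  -- Rescaling makes the radicand equal to 1 at x₀, where the principal power is holomorphic.
  set s : ℂ → ℂ := fun x => rt x₀ * ((3 * x ^ 2 - 4) / (rt x₀) ^ 2) ^ (1 / 2 : ℂ) with hs
  have h1 : (3 * x₀ ^ 2 - 4) / (rt x₀) ^ 2 = 1 := by
    rw [rt_sq, div_self]
    rw [← rt_sq]; exact pow_ne_zero 2 hr
  have hd : DifferentiableAt ℂ s x₀ := by
    refine DifferentiableAt.const_mul (DifferentiableAt.cpow_const (by fun_prop) ?_) _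
    rw [h1]; exact Complex.one_mem_slitPlane
  have hsx : s x₀ = rt x₀ := by simp only [hs, h1, Complex.one_cpow, mul_one]
  have hsq : ∀ x, s x ^ 2 = rt x ^ 2 := fun x => by
    have := Complex.cpow_nat_inv_pow ((3 * x ^ 2 - 4) / (rt x₀) ^ 2) two_ne_zero
    simp only [hs, mul_pow, one_div]
    rw [show ((2 : ℂ)⁻¹) = ((2 : ℕ) : ℂ)⁻¹ by norm_num, this, rt_sq x]
    field_simp
  convert! h s hd hsx using 1
  ext x
  rcases sq_eq_sq_iff_eq_or_eq_neg.1 (hsq x) with h2 | h2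
  · rw [h2]
  · rw [h2, heven]

theorem differentiableAt_comp_inv_root {F : ℂ → ℂ} (hF : DifferentiableOn ℂ F cutPlane) {w : ℂ → ℂ}
    {x₀ : ℂ} (hw : DifferentiableAt ℂ w x₀) (h0 : w x₀ ≠ 0) (hm : 1 / w x₀ ∈ cutPlane) :
    DifferentiableAt ℂ (fun x => F (1 / w x)) x₀ :=
  DifferentiableAt.comp (f := fun x => 1 / w x) x₀ (hF.differentiableAt (isOpen_cutPlane.mem_nhds hm))
    ((differentiableAt_const 1).div hw h0)

theorem differentiableOn_comp_inv {F : ℂ → ℂ} (hF : DifferentiableOn ℂ F cutPlane) :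
    DifferentiableOn ℂ (fun x => F (1 / x)) region := fun _ hx =>
  (differentiableAt_comp_inv_root hF (w := fun x => x) differentiableAt_id
    (ne_zero_of_mem_region hx) (inv_mem_cutPlane_of_mem_region hx)).differentiableWithinAt

theorem differentiableAt_roots {F : ℂ → ℂ} (hF : DifferentiableOn ℂ F cutPlane) {x₀ : ℂ}
    (hx₀ : x₀ ∈ region) {s : ℂ → ℂ} (hs : DifferentiableAt ℂ s x₀) (hs0 : s x₀ = rt x₀) :
    DifferentiableAt ℂ (fun x => F (1 / ((x + Complex.I * s x) / 2))) x₀ ∧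
    DifferentiableAt ℂ (fun x => F (1 / ((x - Complex.I * s x) / 2))) x₀ :=
  ⟨differentiableAt_comp_inv_root hF (w := fun x => (x + Complex.I * s x) / 2) (by fun_prop)
      (by simp only [hs0]; exact rootA_ne_zero hx₀)
      (by simp only [hs0]; exact inv_rootA_mem_cutPlane hx₀),
    differentiableAt_comp_inv_root hF (w := fun x => (x - Complex.I * s x) / 2) (by fun_prop)
      (by simp only [hs0]; exact rootB_ne_zero hx₀)
      (by simp only [hs0]; exact inv_rootB_mem_cutPlane hx₀)⟩

theorem differentiableOn_add_roots {F : ℂ → ℂ} (hF : DifferentiableOn ℂ F cutPlane) :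
    DifferentiableOn ℂ (fun x => F (1 / rootA x) + F (1 / rootB x)) region := fun x₀ hx₀ =>
  (differentiableAt_of_even_in_rt
    (Ψ := fun x s => F (1 / ((x + Complex.I * s) / 2)) + F (1 / ((x - Complex.I * s) / 2)))
    (fun x s => by
      simp only [mul_neg, sub_neg_eq_add, ← sub_eq_add_neg]; ring) hx₀
    (fun s hs hs0 => (differentiableAt_roots hF hx₀ hs hs0).1.add
      (differentiableAt_roots hF hx₀ hs hs0).2)).differentiableWithinAt

theorem differentiableOn_sub_roots_div {F : ℂ → ℂ} (hF : DifferentiableOn ℂ F cutPlane) :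
    DifferentiableOn ℂ (fun x => (F (1 / rootA x) - F (1 / rootB x)) / rt x) region := fun x₀ hx₀ =>
  (differentiableAt_of_even_in_rt
    (Ψ := fun x s => (F (1 / ((x + Complex.I * s) / 2)) - F (1 / ((x - Complex.I * s) / 2))) / s)
    (fun x s => by
      simp only [mul_neg, sub_neg_eq_add, ← sub_eq_add_neg, div_neg]; ring) hx₀
    (fun s hs hs0 => ((differentiableAt_roots hF hx₀ hs hs0).1.sub
      (differentiableAt_roots hF hx₀ hs hs0).2).div hs
        (by rw [hs0]; exact rt_ne_zero hx₀))).differentiableWithinAt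

theorem differentiableOn_kernelInt {W : ℝ → ℂ} (hW : IntervalIntegrable W volume 0 1) :
    DifferentiableOn ℂ (kernelInt W) cutPlane := fun _ hz =>
  (hasDerivAt_kernelInt hW hz).differentiableAt.differentiableWithinAt

theorem differentiableOn_arctanh : DifferentiableOn ℂ arctanh cutPlane := fun _ hz =>
  (hasDerivAt_arctanh hz).differentiableAt.differentiableWithinAt

theorem differentiableOn_frakL : DifferentiableOn ℂ (fun x => frakL x) region :=
  DifferentiableOn.congr (((differentiableOn_comp_inv
    (differentiableOn_kernelInt intervalIntegrable_wlog)).const_mul 2).add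
    (differentiableOn_add_roots (differentiableOn_kernelInt intervalIntegrable_wlog)))
    fun _ hx => frakL_eq hx

theorem differentiableOn_frakl : DifferentiableOn ℂ (fun x => frakl x) region :=
  DifferentiableOn.congr (((differentiableOn_comp_inv
    (differentiableOn_kernelInt intervalIntegrable_well)).const_mul 2).add
    (differentiableOn_add_roots (differentiableOn_kernelInt intervalIntegrable_well)))
    fun _ hx => frakl_eq hx

theorem differentiableOn_frakM_div : DifferentiableOn ℂ (fun x => frakM x / rt x) region :=
  DifferentiableOn.congr
    (differentiableOn_sub_roots_div (differentiableOn_kernelInt intervalIntegrable_wlog)).neg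
    fun x hx => by simp only [frakM_eq hx, neg_div, Pi.neg_apply]

theorem differentiableOn_frakm_div : DifferentiableOn ℂ (fun x => frakm x / rt x) region :=
  DifferentiableOn.congr
    (differentiableOn_sub_roots_div (differentiableOn_kernelInt intervalIntegrable_well))
    fun x hx => by simp only [frakm_eq hx]

/-! ### The continued logarithm -/

/-- The continuation to the region of the principal logarithm of `quot`. -/
noncomputable def contLog (x : ℂ) : ℂ := 2 * (arctanh (1 / rootB x) - arctanh (1 / rootA x))

theorem differentiableOn_contLog_div : DifferentiableOn ℂ (fun x => contLog x / rt x) region :=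
  DifferentiableOn.congr ((differentiableOn_sub_roots_div differentiableOn_arctanh).const_mul (-2))
    fun x _ => by simp only [contLog]; ring

theorem exp_two_mul_arctanh {w : ℂ} (hw0 : w ≠ 0) (hw : 1 / w ∈ cutPlane) :
    Complex.exp (2 * arctanh (1 / w)) = (w + 1) / (w - 1) ∧ w + 1 ≠ 0 ∧ w - 1 ≠ 0 := by
  have n1 := Complex.slitPlane_ne_zero hw.1
  have n2 := Complex.slitPlane_ne_zero hw.2
  have e1 : 1 + 1 / w = (w + 1) / w := by field_simp
  have e2 : 1 - 1 / w = (w - 1) / w := by field_simp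
  refine ⟨?_, fun h => n1 (by rw [e1, h, zero_div]), fun h => n2 (by rw [e2, h, zero_div])⟩
  rw [arctanh, mul_div_cancel₀ _ two_ne_zero, Complex.exp_sub, Complex.exp_log n1,
    Complex.exp_log n2, e1, e2, div_div_div_cancel_right₀ hw0]

/-- Exponentiating gives (b + 1)(a - 1)/((b - 1)(a + 1)); expanding with ab = x² - 1 and a - b =
i√(3x² - 4) gives the quotient. -/
theorem exp_contLog {x : ℂ} (hx : x ∈ region) : Complex.exp (contLog x) = quot x := by
  obtain ⟨h1, n1, n2⟩ := exp_two_mul_arctanh (rootA_ne_zero hx) (inv_rootA_mem_cutPlane hx)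
  obtain ⟨h2, n3, n4⟩ := exp_two_mul_arctanh (rootB_ne_zero hx) (inv_rootB_mem_cutPlane hx)
  rw [contLog, mul_sub, Complex.exp_sub, h1, h2, div_div_div_eq, quot, ← rootA_sub_rootB]
  have h := rootA_mul_rootB x
  congr 1
  · linear_combination h
  · linear_combination h

theorem mem_region_of_sqrt_two_le {x : ℂ} (hx : Real.sqrt 2 ≤ ‖x‖) : x ∈ region := by
  rw [mem_region_iff, norm_mul, mul_pow]
  have h2 : 2 ≤ ‖x‖ ^ 2 := by
    have := pow_le_pow_left₀ (Real.sqrt_nonneg 2) hx 2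
    rwa [Real.sq_sqrt (by norm_num)] at this
  have h3 : 1 ≤ ‖1 - x ^ 2‖ := by
    have := norm_sub_norm_le (x ^ 2) 1
    rw [norm_sub_rev, norm_pow, norm_one] at this
    linarith
  nlinarith [one_le_pow₀ h3 (n := 2)]

/-- Squaring eliminates the root: u = x² satisfies A(u - 2)² = B(4 - 3u) with 0 ≤ B < A. This real
quadratic has no root with |u| ≥ 2 other than u = 2. -/
theorem sq_eq_two_of_quot_eq {x : ℂ} (hx : Real.sqrt 2 ≤ ‖x‖) {ρ : ℝ} (hρ : 0 < ρ)
    (h : quot x = -(ρ : ℂ)) : x ^ 2 = 2 := by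
  have h2 : 2 ≤ ‖x‖ ^ 2 := by
    have := pow_le_pow_left₀ (Real.sqrt_nonneg 2) hx 2
    rwa [Real.sq_sqrt (by norm_num)] at this
  have hden : x ^ 2 - 2 - Complex.I * rt x ≠ 0 := by
    intro h0
    rw [quot, h0, div_zero] at h
    have : (ρ : ℂ) = 0 := by linear_combination h
    exact hρ.ne' (by exact_mod_cast this)
  rw [quot, div_eq_iff hden] at h
  have hs := rt_sq x
  have h3 : (1 + ρ : ℂ) * (x ^ 2 - 2) = (ρ - 1) * (Complex.I * rt x) := by linear_combination h
  have h4 : ((1 + ρ) ^ 2 : ℂ) * (x ^ 2 - 2) ^ 2 = (ρ - 1) ^ 2 * (4 - 3 * x ^ 2) := by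
    have := congrArg (· ^ 2) h3
    simp only [mul_pow] at this
    rw [Complex.I_sq, hs] at this
    linear_combination this
  set u : ℂ := x ^ 2 with hu
  have hn : 4 ≤ u.re ^ 2 + u.im ^ 2 := by
    have h5 : 2 ≤ ‖u‖ := by rw [hu, norm_pow]; exact h2
    have h6 := Complex.sq_norm u
    rw [Complex.normSq_apply] at h6
    nlinarith
  have hA : (0 : ℝ) < (1 + ρ) ^ 2 := by positivity
  have hB : 0 ≤ (ρ - 1) ^ 2 := sq_nonneg _
  have hAB : (ρ - 1) ^ 2 < (1 + ρ) ^ 2 := by nlinarith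
  have e : (((1 + ρ) ^ 2 : ℝ) : ℂ) * (u - 2) ^ 2 = (((ρ - 1) ^ 2 : ℝ) : ℂ) * (4 - 3 * u) := by
    push_cast; exact h4
  generalize (1 + ρ) ^ 2 = A at *
  generalize (ρ - 1) ^ 2 = B at *
  have hre := congrArg Complex.re e
  have him := congrArg Complex.im e
  rw [Complex.re_ofReal_mul, Complex.re_ofReal_mul] at hre
  rw [Complex.im_ofReal_mul, Complex.im_ofReal_mul] at him
  simp [pow_two] at hre him
  set p := u.re
  set q := u.im
  -- A nonreal root has |u|² equal to the product of the two conjugate roots, 4 - 4B/A; |u| ≥ 2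
  -- forces B = 0 and hence the double root 2, which is real.
  have hq : q = 0 := by
    by_contra hq
    have i1 : 2 * A * (p - 2) = -3 * B := by
      have : q * (2 * A * (p - 2) + 3 * B) = 0 := by linear_combination him
      rcases mul_eq_zero.1 this with h | h
      · exact absurd h hq
      · linarith
    have i2 : A * (p ^ 2 + q ^ 2) = 4 * A - 4 * B := by
      linear_combination -hre + p * i1
    have i3 : B = 0 := by nlinarith
    have i4 : p = 2 := by
      rw [i3, mul_zero] at i1
      have := (mul_eq_zero.1 i1).resolve_left (by positivity)
      linarith
    rw [i4, i3] at i2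
    have : A * q ^ 2 = 0 := by linarith
    rcases mul_eq_zero.1 this with h | h
    · exact hA.ne' h
    · exact hq (pow_eq_zero_iff two_ne_zero |>.1 h)
  rw [hq] at hre hn
  -- For p ≥ 2 the two sides have opposite signs unless p = 2; for p ≤ -2 the left side exceeds the
  -- right because p² > p and A > B.
  have hp : p = 2 := by
    have hr' : A * (p - 2) ^ 2 = B * (4 - 3 * p) := by linear_combination hre
    rcases le_total 0 p with h0 | h0
    · have : 2 ≤ p := by nlinarith
      have h5 : (p - 2) ^ 2 ≤ 0 := by
        have : A * (p - 2) ^ 2 ≤ 0 := by rw [hr']; exact mul_nonpos_of_nonneg_of_nonpos hB (by linarith)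
        nlinarith
      have := pow_eq_zero_iff two_ne_zero |>.1 (le_antisymm h5 (sq_nonneg _))
      linarith
    · exfalso
      nlinarith
  apply Complex.ext
  · simpa using hp
  · simpa using hq

theorem im_two_mul_arctanh (z : ℂ) :
    (2 * arctanh z).im = Complex.arg (1 + z) - Complex.arg (1 - z) := by
  rw [arctanh, mul_div_cancel₀ _ two_ne_zero, Complex.sub_im, Complex.log_im, Complex.log_im]

theorem im_two_mul_arctanh_pos {z : ℂ} (hz : 0 < z.im) : 0 < (2 * arctanh z).im := by
  rw [im_two_mul_arctanh]
  have h1 : 0 ≤ Complex.arg (1 + z) := Complex.arg_nonneg_iff.2 (by simp; exact hz.le)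
  have h2 : Complex.arg (1 - z) < 0 := Complex.arg_neg_iff.2 (by simp; exact hz)
  linarith

theorem im_two_mul_arctanh_neg {z : ℂ} (hz : z.im < 0) : (2 * arctanh z).im < 0 := by
  rw [im_two_mul_arctanh]
  have h1 : 0 ≤ Complex.arg (1 - z) := Complex.arg_nonneg_iff.2 (by simp; exact hz.le)
  have h2 : Complex.arg (1 + z) < 0 := Complex.arg_neg_iff.2 (by simp; exact hz)
  linarith

/-- At these points the quotient is -1, so the sign of the imaginary part must be settled
separately. As ab = 1, inversion exchanges the two roots, which lie in opposite half-planes. -/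
theorem im_contLog_pos {x : ℂ} (hx : x ^ 2 = 2) : 0 < (contLog x).im := by
  have hr : rt x = ((2 : ℝ) ^ (1 / 2 : ℝ) : ℝ) := by
    rw [rt, hx, Complex.ofReal_cpow two_pos.le]
    norm_num
  set r : ℝ := (2 : ℝ) ^ (1 / 2 : ℝ) with hrdef
  have hr0 : 0 < r := by positivity
  have hrt := rt_sq x
  have him : x.im = 0 := by
    have h1 := congrArg Complex.re hx
    have h2 := congrArg Complex.im hx
    simp [pow_two] at h1 h2
    have h3 : x.re * x.im = 0 := by linarith
    rcases mul_eq_zero.1 h3 with h | h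
    · rw [h] at h1; nlinarith [mul_self_nonneg x.im]
    · exact h
  have hab : rootA x * rootB x = 1 := by rw [rootA_mul_rootB, hx]; norm_num
  have hA : 1 / rootA x = rootB x := by
    rw [eq_comm, eq_div_iff (left_ne_zero_of_mul_eq_one hab), mul_comm, hab]
  have hB : 1 / rootB x = rootA x := by
    rw [eq_comm, eq_div_iff (right_ne_zero_of_mul_eq_one hab), hab]
  have h1 : 0 < (rootA x).im := by
    rw [rootA, hr]
    simp [him, hr0]
  have h2 : (rootB x).im < 0 := by
    rw [rootB, hr]
    simp [him]
    linarith
  rw [contLog, mul_sub, Complex.sub_im, hA, hB]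
  linarith [im_two_mul_arctanh_pos h1, im_two_mul_arctanh_neg h2]

/-- Since x² = ax - a² + 1, having |a| ≤ |x|/2 would give |x|² ≤ (3/4)|x|² + 1, that is |x| ≤ 2.
Hence both roots tend to infinity with x. -/
theorem norm_lt_two_mul_norm_of_root {a b x : ℂ} (h1 : a + b = x) (h2 : a * b = x ^ 2 - 1)
    (hx : 2 < ‖x‖) : ‖x‖ < 2 * ‖a‖ := by
  by_contra! h
  have e : x ^ 2 = a * x - a ^ 2 + 1 := by rw [← h1] at h2 ⊢; linear_combination -h2
  have h3 : ‖x‖ ^ 2 ≤ ‖a‖ * ‖x‖ + ‖a‖ ^ 2 + 1 := by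
    rw [← norm_pow, e]
    refine (norm_add_le _ _).trans ?_
    rw [norm_one]
    gcongr
    refine (norm_sub_le _ _).trans ?_
    rw [norm_mul, norm_pow]
  nlinarith [norm_nonneg a]

theorem exists_norm_contLog_lt : ∃ R : ℝ, ∀ x : ℂ, R < ‖x‖ → ‖contLog x‖ < 3 := by
  have hc := (hasDerivAt_arctanh zero_mem_cutPlane).continuousAt
  have h0 : arctanh 0 = 0 := by simp [arctanh]
  -- Two terms below 3/4, doubled, stay below 3, hence below π.
  obtain ⟨δ, hδ, h⟩ := Metric.continuousAt_iff.1 hc (3 / 4) (by norm_num)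
  simp only [dist_zero_right, h0] at h
  have key : ∀ x : ℂ, max 2 (2 / δ) < ‖x‖ → ∀ a b : ℂ, a + b = x → a * b = x ^ 2 - 1 →
      ‖arctanh (1 / a)‖ < 3 / 4 := fun x hx a b h1 h2 => by
    have h3 := norm_lt_two_mul_norm_of_root h1 h2 (lt_of_le_of_lt (le_max_left _ _) hx)
    have h4 : 2 / δ < ‖x‖ := lt_of_le_of_lt (le_max_right _ _) hx
    have ha : 0 < ‖a‖ := by
      have : 0 < 2 / δ := by positivity
      linarith
    refine h ?_
    rw [norm_div, norm_one, div_lt_iff₀ ha]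
    rw [div_lt_iff₀ hδ] at h4
    nlinarith
  refine ⟨max 2 (2 / δ), fun x hx => ?_⟩
  have hA := key x hx _ _ (rootA_add_rootB x) (rootA_mul_rootB x)
  have hB := key x hx (rootB x) (rootA x) ((add_comm _ _).trans (rootA_add_rootB x))
    ((mul_comm _ _).trans (rootA_mul_rootB x))
  rw [contLog, norm_mul, Complex.norm_ofNat]
  have := norm_sub_le (arctanh (1 / rootB x)) (arctanh (1 / rootA x))
  linarith

/-- This expresses (Im w)² through w² alone, so the sign jumps of `contLog` along the cut of `rt`
become invisible. -/
theorem sq_im_eq (w : ℂ) : w.im ^ 2 = (‖w ^ 2‖ - (w ^ 2).re) / 2 := by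
  rw [norm_pow, Complex.sq_norm, Complex.normSq_apply, pow_two w, Complex.mul_re]
  ring

theorem sq_eq_two_of_im_contLog {x : ℂ} (hx : Real.sqrt 2 ≤ ‖x‖)
    (h : (contLog x).im ^ 2 = Real.pi ^ 2) : x ^ 2 = 2 := by
  refine sq_eq_two_of_quot_eq hx (Real.exp_pos (contLog x).re) ?_
  rw [← exp_contLog (mem_region_of_sqrt_two_le hx), Complex.exp_eq_exp_re_mul_sin_add_cos,
    ← Complex.ofReal_exp, ← Complex.ofReal_cos, ← Complex.ofReal_sin]
  rcases sq_eq_sq_iff_eq_or_eq_neg.1 h with h | h <;> simp [h]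

theorem contLog_eq_log {x : ℂ} (hx : Real.sqrt 2 ≤ ‖x‖) : contLog x = Complex.log (quot x) := by
  have hx0 : 0 < ‖x‖ := lt_of_lt_of_le (by positivity) hx
  obtain ⟨R, hR⟩ := exists_norm_contLog_lt
  -- This is the square of `contLog` along the ray, written through the holomorphic quotient so that
  -- its continuity is evident.
  set q : ℝ → ℂ := fun r => (3 * ((r : ℂ) * x) ^ 2 - 4) * (contLog (r * x) / rt (r * x)) ^ 2 with hq
  have hnorm : ∀ r : ℝ, 1 ≤ r → ‖(r : ℂ) * x‖ = r * ‖x‖ := fun r hr => by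
    rw [norm_mul, Complex.norm_real, Real.norm_of_nonneg (by linarith)]
  have hray : ∀ r : ℝ, 1 ≤ r → Real.sqrt 2 ≤ ‖(r : ℂ) * x‖ := fun r hr => by
    rw [hnorm r hr]; nlinarith
  have hqeq : ∀ r : ℝ, 1 ≤ r → q r = contLog (r * x) ^ 2 := fun r hr => by
    have h1 := rt_ne_zero (mem_region_of_sqrt_two_le (hray r hr))
    simp only [hq]
    rw [← rt_sq]; field_simp
  set f : ℝ → ℝ := fun r => (‖q r‖ - (q r).re) / 2 with hf
  have hfeq : ∀ r : ℝ, 1 ≤ r → f r = (contLog (r * x)).im ^ 2 := fun r hr => by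
    simp only [hf]; rw [hqeq r hr, ← sq_im_eq]
  have hqc : ContinuousOn q (Ici 1) := by
    refine ContinuousOn.mul (by fun_prop) (ContinuousOn.pow ?_ 2)
    exact differentiableOn_contLog_div.continuousOn.comp (f := fun r : ℝ => (r : ℂ) * x) (by fun_prop)
      fun r hr => mem_region_of_sqrt_two_le (hray r hr)
  have hfc : ContinuousOn f (Ici 1) :=
    (hqc.norm.sub (Complex.continuous_re.comp_continuousOn hqc)).div_const 2
  -- If (Im)² exceeded π² at r = 1, then, being below π² far out, it would equal π² at some r ≥ 1.
  -- There (rx)² = 2, and |x| ≥ √2 forces r = 1, a contradiction.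
  have hmain : f 1 ≤ Real.pi ^ 2 ∧ (f 1 = Real.pi ^ 2 → x ^ 2 = 2) := by
    refine ⟨?_, fun h => ?_⟩
    · by_contra! h
      set S : ℝ := max 1 ((R + 1) / ‖x‖) with hS
      have hS1 : 1 ≤ S := le_max_left _ _
      have hfS : f S < Real.pi ^ 2 := by
        have h1 : R < ‖(S : ℂ) * x‖ := by
          rw [hnorm S hS1]
          have : (R + 1) / ‖x‖ ≤ S := le_max_right _ _
          rw [div_le_iff₀ hx0] at this
          linarith
        have h2 := (Complex.abs_im_le_norm _).trans_lt (hR _ h1)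
        rw [hfeq S hS1, ← sq_abs]
        have := Real.pi_gt_three
        nlinarith [abs_nonneg (contLog ((S : ℂ) * x)).im]
      obtain ⟨r, hr, hrf⟩ := intermediate_value_Icc' hS1 (hfc.mono Icc_subset_Ici_self)
        ⟨hfS.le, h.le⟩
      have h2 : (r * x) ^ 2 = 2 :=
        sq_eq_two_of_im_contLog (hray r hr.1) (by rw [← hfeq r hr.1, hrf])
      have h3 : (r * ‖x‖) ^ 2 = 2 := by
        rw [← hnorm r hr.1, ← norm_pow, h2, Complex.norm_ofNat]
      have h4 : 2 ≤ ‖x‖ ^ 2 := by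
        have := pow_le_pow_left₀ (Real.sqrt_nonneg 2) hx 2
        rwa [Real.sq_sqrt (by norm_num)] at this
      have h5 : r = 1 := by
        have h6 : r ^ 2 * ‖x‖ ^ 2 = 2 := by rw [← mul_pow, h3]
        have h7 : r ^ 2 ≤ 1 := by nlinarith [sq_nonneg r]
        nlinarith [hr.1]
      rw [h5] at hrf
      linarith
    · refine sq_eq_two_of_im_contLog hx ?_
      rw [← h, hfeq 1 le_rfl]; simp
  have hf1 : f 1 = (contLog x).im ^ 2 := by rw [hfeq 1 le_rfl]; simp
  rw [hf1] at hmain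
  have habs := abs_le_of_sq_le_sq' hmain.1 Real.pi_pos.le
  -- The principal range is half-open; the value -π could occur only at x² = 2, where the imaginary
  -- part is positive.
  have hlt : -Real.pi < (contLog x).im := by
    refine lt_of_le_of_ne habs.1 fun h => ?_
    have := im_contLog_pos (hmain.2 (by rw [← h, neg_sq]))
    linarith [Real.pi_pos]
  rw [← exp_contLog (mem_region_of_sqrt_two_le hx), Complex.log_exp hlt habs.2]

/-! ### Combined series and closed forms of the integrals -/

/-- The correction is removed through 6/((6k+1)(6k+5)) = (3/2)(1/(6k+1) - 1/(6k+5)). -/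
theorem seriesEq_C2 {x : ℂ} (hx : 4 / 27 < ‖x * (1 - x ^ 2)‖ ^ 2) :
    SeriesEq 0 (fun k => H k - H (2 * k) + 2 * Complex.log 2) (fun k => 6 * (k : ℂ) + 5) x
      ((x * (1 - x ^ 2)) ^ 2 * genInt well (-1) 9 (-9) (x * (1 - x ^ 2))
        + 3 / 2 * ((x * (1 - x ^ 2)) ^ 2 * genInt (fun _ => 1) 1 0 0 (x * (1 - x ^ 2))
          - (x * (1 - x ^ 2)) ^ 2 * genInt (fun _ => 1) 2 0 (-9) (x * (1 - x ^ 2)))) := by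
  have h := HasSum.add (seriesEq_C2_aux hx) (((seriesEq_B1 hx).sub (seriesEq_C1 hx)).mul_left (3 / 2))
  rw [SeriesEq]
  convert! h using 1
  ext j
  simp only [summand_eq, add_zero]
  have e1 := six_mul_add_one_ne_zero j
  have e2 := six_mul_add_five_ne_zero j
  generalize hu : (6 * j + 1 : ℂ) = u at *
  generalize hv : (6 * j + 5 : ℂ) = v at *
  rw [← sub_div, ← mul_div_assoc, ← add_div]
  congr 1
  field_simp
  rw [show v = u + 4 by rw [← hu, ← hv]; ring]
  ring

theorem seriesEq_D4 {x : ℂ} (hx : 4 / 27 < ‖x * (1 - x ^ 2)‖ ^ 2) :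
    SeriesEq 1 (fun k => 1 / (2 * (k : ℂ) - 1)) (fun k => 2 * (k : ℂ) - 1) x
      (genInt wlog (-1) 3 0 (x * (1 - x ^ 2))
        - 1 / 2 * genInt (fun _ => 1) 1 (-2) 1 (x * (1 - x ^ 2))
        + 1 / 4 * genInt (fun _ => 1) 0 4 (-4) (x * (1 - x ^ 2))) := by
  have h := HasSum.add (HasSum.sub (seriesEq_D4_aux hx) ((seriesEq_D1 hx).mul_left (1 / 2)))
    ((seriesEq_A1 hx).mul_left (1 / 4))
  rw [SeriesEq]
  convert! h using 1
  ext j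
  simp only [summand_eq]
  have e1 := two_mul_add_one_ne_zero j
  have e2 : (j + 1 : ℂ) ≠ 0 := by exact_mod_cast j.succ_ne_zero
  push_cast
  rw [show (2 * (j + 1) - 1 : ℂ) = 2 * j + 1 by ring]
  generalize (2 * j + 1 : ℂ) = s at *
  generalize (j + 1 : ℂ) = t at *
  rw [← mul_div_assoc, ← mul_div_assoc (1 / 4 : ℂ), ← sub_div, ← add_div]
  congr 1
  field_simp
  ring

theorem arctanh_rootA {x : ℂ} (hx : x ∈ region) :
    arctanh (1 / rootA x) = arctanh (1 / x) / 2 - contLog x / 4 := by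
  rw [contLog, ← arctanh_add_arctanh hx]; ring

theorem arctanh_rootB {x : ℂ} (hx : x ∈ region) :
    arctanh (1 / rootB x) = arctanh (1 / x) / 2 + contLog x / 4 := by
  rw [contLog, ← arctanh_add_arctanh hx]; ring

theorem genInt_one_eq {x : ℂ} (hx : x ∈ region) (q₀ q₁ q₂ : ℂ) :
    genInt (fun _ => 1) q₀ q₁ q₂ (x * (1 - x ^ 2))
      = 1 / (2 * (x * (1 - x ^ 2)) * (1 - 3 * x ^ 2)) *
        ((q₀ + q₁ * x ^ 2 + q₂ * x ^ 4) * (2 * arctanh (1 / x))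
        - (-1 / 2 * q₀ + (x ^ 2 - 1 / 2) * q₁ + (3 * x ^ 2 - 1 - x ^ 4) / 2 * q₂)
          * (2 * arctanh (1 / x))
        - Complex.I / rt x * (3 * x / 2 * q₀ + x / 2 * q₁ + (-x + 5 * x ^ 3 - 3 * x ^ 5) / 2 * q₂)
          * contLog x) := by
  rw [genInt_eq hx intervalIntegrable_one, kernelInt_one (inv_mem_cutPlane_of_mem_region hx),
    kernelInt_one (inv_rootA_mem_cutPlane hx), kernelInt_one (inv_rootB_mem_cutPlane hx),
    arctanh_rootA hx, arctanh_rootB hx]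
  ring

theorem genInt_wlog_eq {x : ℂ} (hx : x ∈ region) (q₀ q₁ q₂ : ℂ) :
    genInt wlog q₀ q₁ q₂ (x * (1 - x ^ 2))
      = 1 / (2 * (x * (1 - x ^ 2)) * (1 - 3 * x ^ 2)) *
        ((q₀ + q₁ * x ^ 2 + q₂ * x ^ 4) * (Li2 (-1 / x) - Li2 (1 / x))
        - (-1 / 2 * q₀ + (x ^ 2 - 1 / 2) * q₁ + (3 * x ^ 2 - 1 - x ^ 4) / 2 * q₂)
          * (frakL x - 2 * (Li2 (-1 / x) - Li2 (1 / x)))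
        - Complex.I / rt x * (3 * x / 2 * q₀ + x / 2 * q₁ + (-x + 5 * x ^ 3 - 3 * x ^ 5) / 2 * q₂)
          * frakM x) := by
  rw [genInt_eq hx intervalIntegrable_wlog, frakL_eq hx, frakM_eq hx,
    ← kernelInt_wlog_inv (inv_mem_cutPlane_of_mem_region hx)]
  ring

theorem genInt_well_eq {x : ℂ} (hx : x ∈ region) (q₀ q₁ q₂ : ℂ) :
    genInt well q₀ q₁ q₂ (x * (1 - x ^ 2))
      = 1 / (2 * (x * (1 - x ^ 2)) * (1 - 3 * x ^ 2)) *
        ((q₀ + q₁ * x ^ 2 + q₂ * x ^ 4) * beta x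
        - (-1 / 2 * q₀ + (x ^ 2 - 1 / 2) * q₁ + (3 * x ^ 2 - 1 - x ^ 4) / 2 * q₂)
          * (frakl x - 2 * beta x)
        + Complex.I / rt x * (3 * x / 2 * q₀ + x / 2 * q₁ + (-x + 5 * x ^ 3 - 3 * x ^ 5) / 2 * q₂)
          * frakm x) := by
  rw [genInt_eq hx intervalIntegrable_well, frakl_eq hx, frakm_eq hx,
    ← kernelInt_well_inv (ne_zero_of_mem_region hx) (inv_mem_cutPlane_of_mem_region hx)]
  ring

theorem wath_kernel_eq {w : ℂ} (hw : w ≠ 0) (h : 1 / w ∈ cutPlane) :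
    ∫ y in (0 : ℝ)..1, wath y * (2 * (y : ℂ) / (w ^ 2 - (y : ℂ) ^ 2)) = arctanh (1 / w) ^ 2 := by
  rw [← integral_wath_kernel h]
  congr 1; ext y
  have e : 1 - (1 / w) ^ 2 * (y : ℂ) ^ 2 = (w ^ 2 - (y : ℂ) ^ 2) / w ^ 2 := by field_simp
  rw [e, div_div_eq_mul_div]
  congr 2
  field_simp

/-- With p = y(1 - y²), the rational factor p p'/(c² - p²) is -1/2 times the logarithmic derivative
of c² - p² = ∏ (w² - y²), so it is the sum of y/(w² - y²) over the three roots; each term integrates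
by `wath_kernel_eq`. -/
theorem integral_wath_div {x : ℂ} (hx : x ∈ region) :
    ∫ y in (0 : ℝ)..1, wath y * ((y : ℂ) * (1 - y ^ 2) * (1 - 3 * y ^ 2))
        / ((x * (1 - x ^ 2)) ^ 2 - ((y : ℂ) * (1 - (y : ℂ) ^ 2)) ^ 2)
      = 1 / 2 * (arctanh (1 / x) ^ 2 + arctanh (1 / rootA x) ^ 2 + arctanh (1 / rootB x) ^ 2) := by
  have mx := inv_mem_cutPlane_of_mem_region hx
  have ma := inv_rootA_mem_cutPlane hx
  have mb := inv_rootB_mem_cutPlane hx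
  have x0 := ne_zero_of_mem_region hx
  have a0 := rootA_ne_zero hx
  have b0 := rootB_ne_zero hx
  have hi : ∀ w : ℂ, w ≠ 0 → 1 / w ∈ cutPlane → IntervalIntegrable
      (fun y : ℝ => wath y * (2 * (y : ℂ) / (w ^ 2 - (y : ℂ) ^ 2))) volume 0 1 := fun w hw h =>
    intervalIntegrable_wath.mul_continuousOn_zero_one
      (ContinuousOn.div (by fun_prop) (by fun_prop) fun y hy => sq_sub_ofReal_sq_ne_zero hw h hy)
  rw [← wath_kernel_eq x0 mx, ← wath_kernel_eq a0 ma, ← wath_kernel_eq b0 mb,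
    ← intervalIntegral.integral_add (hi _ x0 mx) (hi _ a0 ma),
    ← intervalIntegral.integral_add ((hi _ x0 mx).add (hi _ a0 ma)) (hi _ b0 mb),
    ← intervalIntegral.integral_const_mul]
  refine intervalIntegral.integral_congr fun y hy => ?_
  rw [uIcc_of_le zero_le_one] at hy
  have nx := sq_sub_ofReal_sq_ne_zero x0 mx hy
  have na := sq_sub_ofReal_sq_ne_zero a0 ma hy
  have nb := sq_sub_ofReal_sq_ne_zero b0 mb hy
  have h1 := rootA_add_rootB x
  have h2 := rootA_mul_rootB x
  generalize rootA x = a at *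
  generalize rootB x = b at *
  generalize (y : ℂ) = t at *
  have hD : (x * (1 - x ^ 2)) ^ 2 - (t * (1 - t ^ 2)) ^ 2
      = (x ^ 2 - t ^ 2) * ((a ^ 2 - t ^ 2) * (b ^ 2 - t ^ 2)) := by
    linear_combination (-(x ^ 2 - t ^ 2)) * ((a * b + x ^ 2 - 1 + 2 * t ^ 2) * h2
      - t ^ 2 * (a + b + x) * h1)
  have hS : (1 - t ^ 2) * (1 - 3 * t ^ 2) = (a ^ 2 - t ^ 2) * (b ^ 2 - t ^ 2)
      + (x ^ 2 - t ^ 2) * ((a ^ 2 - t ^ 2) + (b ^ 2 - t ^ 2)) := by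
    linear_combination (-((a * b + x ^ 2 - 1 + 2 * t ^ 2) * h2 - t ^ 2 * (a + b + x) * h1))
      - (x ^ 2 - t ^ 2) * ((a + b + x) * h1 - 2 * h2)
  have e : t * (1 - t ^ 2) * (1 - 3 * t ^ 2) = t * ((a ^ 2 - t ^ 2) * (b ^ 2 - t ^ 2)
      + (x ^ 2 - t ^ 2) * ((a ^ 2 - t ^ 2) + (b ^ 2 - t ^ 2))) := by rw [← hS]; ring
  rw [hD, e]
  generalize x ^ 2 - t ^ 2 = X at *
  generalize a ^ 2 - t ^ 2 = A at *
  generalize b ^ 2 - t ^ 2 = B at *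
  field_simp
  ring

/-- Moving the root into the denominator lets the final identities be checked with `rt x` as an
independent symbol. -/
theorem I_mul_rt_div {x : ℂ} (hx : x ∈ region) :
    Complex.I * x * rt x / 2 = Complex.I * x * (3 * x ^ 2 - 4) / (2 * rt x) := by
  have := rt_ne_zero hx
  rw [← rt_sq]; field_simp

end BinomialSeries

theorem mainTheorem7 :
    DifferentiableOn ℂ (fun x => frakL x) region ∧
    DifferentiableOn ℂ (fun x => frakM x / rt x) region ∧
    DifferentiableOn ℂ (fun x => frakl x) region ∧
    DifferentiableOn ℂ (fun x => frakm x / rt x) region ∧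
    DifferentiableOn ℂ (fun x => arctanh (1 / x)) region ∧
    -- `lg` is the continuation of the logarithm of the quotient, unique since `region` is connected
    ∃ lg : ℂ → ℂ,
      DifferentiableOn ℂ (fun x => lg x / rt x) region ∧
      (∀ x ∈ region, Complex.exp (lg x) = quot x) ∧
      (∀ x : ℂ, Real.sqrt 2 ≤ ‖x‖ → lg x = Complex.log (quot x)) ∧
      ∀ x ∈ region,
        -- (A), denominators `k`
        SeriesEq 1 (fun _ => 1) (fun k => (k : ℂ)) x
          (1 / (1 - 3 * x ^ 2) * (6 * x * arctanh (1 / x)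
            + Complex.I * (3 * x ^ 2 - 2) / rt x * lg x)) ∧
        SeriesEq 1 (fun k => -H k + 2 * H (2 * k) + H (3 * k) - 2 * H (6 * k))
          (fun k => (k : ℂ)) x
          (2 / (1 - 3 * x ^ 2) * (x * frakL x
            + Complex.I * (3 * x ^ 2 - 2) * frakM x / rt x)) ∧
        SeriesEq 1 (fun k => H k - H (2 * k) - 1 / (2 * k) + 2 * Complex.log 2)
          (fun k => (k : ℂ)) x
          (1 / (1 - 3 * x ^ 2) * (x * frakl x
            - Complex.I * (3 * x ^ 2 - 2) * frakm x / rt x)) ∧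
        SeriesEq 1 (fun k => 1 / (k : ℂ)) (fun k => (k : ℂ)) x
          (-6 * arctanh (1 / x) ^ 2 - 1 / 2 * lg x ^ 2) ∧
        -- (B), denominators `6k+1`
        SeriesEq 0 (fun _ => 1) (fun k => 6 * (k : ℂ) + 1) x
          (3 * x * (1 - x ^ 2) / (2 * (1 - 3 * x ^ 2)) * (arctanh (1 / x)
            - Complex.I * x / (2 * rt x) * lg x)) ∧
        SeriesEq 0 (fun k => -H k + 2 * H (2 * k) + H (3 * k) - 2 * H (6 * k + 1))
          (fun k => 6 * (k : ℂ) + 1) x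
          (x * (1 - x ^ 2) / (2 * (1 - 3 * x ^ 2)) * (frakL x
            - 3 * Complex.I * x * frakM x / rt x)) ∧
        SeriesEq 0 (fun k => H k - H (2 * k) + 2 * Complex.log 2)
          (fun k => 6 * (k : ℂ) + 1) x
          (x * (1 - x ^ 2) / (4 * (1 - 3 * x ^ 2)) * (frakl x
            + 3 * Complex.I * x * frakm x / rt x)) ∧
        -- (C), denominators `6k+5`
        SeriesEq 0 (fun _ => 1) (fun k => 6 * (k : ℂ) + 5) x
          (3 * x * (1 - x ^ 2) / (2 * (3 * x ^ 2 - 1))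
            * ((9 * x ^ 4 - 9 * x ^ 2 + 1) * arctanh (1 / x)
              + Complex.I * x * (9 * x ^ 4 - 15 * x ^ 2 + 5) / (2 * rt x) * lg x)) ∧
        SeriesEq 0 (fun k => H k - H (2 * k) + 2 * Complex.log 2)
          (fun k => 6 * (k : ℂ) + 5) x
          (x * (1 - x ^ 2) / (4 * (3 * x ^ 2 - 1))
            * ((9 * x ^ 4 - 9 * x ^ 2 + 1) * frakl x
              - 3 * Complex.I * x * (9 * x ^ 4 - 15 * x ^ 2 + 5) * frakm x / rt x)
            - 9 * x * (1 - x ^ 2) / 4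
              * ((3 * x ^ 2 - 2) * arctanh (1 / x) + Complex.I * x * rt x / 2 * lg x)) ∧
        -- (D), denominators `2k-1`
        SeriesEq 1 (fun _ => 1) (fun k => 2 * (k : ℂ) - 1) x
          (1 / (2 * (1 - x ^ 2) * (1 - 3 * x ^ 2))
            * ((3 * x ^ 4 - 3 * x ^ 2 + 2) / x * arctanh (1 / x)
              + Complex.I * x ^ 2 * (3 * x ^ 2 - 5) / (2 * rt x) * lg x)) ∧
        SeriesEq 1 (fun k => -H k + 2 * H (2 * k) + H (3 * k) - 2 * H (6 * k) - 2 / (2 * k - 1))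
          (fun k => 2 * (k : ℂ) - 1) x
          (1 / (x * (1 - x ^ 2)) * (Li2 (-1 / x) - Li2 (1 / x))
            + x / (2 * (1 - x ^ 2) * (1 - 3 * x ^ 2))
              * ((1 + x ^ 2) * frakL x
                + Complex.I * x * (3 * x ^ 2 - 5) * frakM x / rt x)) ∧
        SeriesEq 1 (fun k => H k - H (2 * k) + 2 / (2 * k - 1) + 2 * Complex.log 2)
          (fun k => 2 * (k : ℂ) - 1) x
          (1 / (2 * x * (1 - x ^ 2)) * beta x
            + x / (4 * (1 - x ^ 2) * (1 - 3 * x ^ 2))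
              * ((1 + x ^ 2) * frakl x
                - Complex.I * x * (3 * x ^ 2 - 5) * frakm x / rt x)) ∧
        SeriesEq 1 (fun k => 1 / (2 * (k : ℂ) - 1)) (fun k => 2 * (k : ℂ) - 1) x
          (-3 / (2 * x * (1 - x ^ 2)) * (Li2 (-1 / x) - Li2 (1 / x))
            + frakL x / (2 * x * (1 - x ^ 2))
            + 1 / (4 * x * (1 - x ^ 2))
              * ((3 * x ^ 2 - 2) * arctanh (1 / x) + Complex.I * x * rt x / 2 * lg x)) := by
  refine ⟨differentiableOn_frakL, differentiableOn_frakM_div, differentiableOn_frakl,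
    differentiableOn_frakm_div, differentiableOn_comp_inv differentiableOn_arctanh, contLog,
    differentiableOn_contLog_div, fun x hx => exp_contLog hx, fun x hx => contLog_eq_log hx,
    fun x hx => ?_⟩
  have hc := mem_region_iff.1 hx
  have x0 := ne_zero_of_mem_region hx
  have hP := one_sub_sq_ne_zero hx
  have hD := one_sub_three_mul_sq_ne_zero hx
  have hr := rt_ne_zero hx
  have hD' : 3 * x ^ 2 - 1 = -(1 - 3 * x ^ 2) := by ring
  have hI := I_mul_rt_div hx
  refine ⟨?_, ?_, ?_, ?_, ?_, ?_, ?_, ?_, ?_, ?_, ?_, ?_, ?_⟩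
  · convert! seriesEq_A1 hc using 1
    rw [genInt_one_eq hx]
    field_simp
    ring
  · convert! seriesEq_A2 hc using 1
    rw [genInt_wlog_eq hx]
    field_simp
    ring
  · convert! seriesEq_A3 hc using 1
    rw [genInt_well_eq hx]
    field_simp
    ring
  · convert! seriesEq_A4 hc using 1
    rw [integral_wath_div hx, arctanh_rootA hx, arctanh_rootB hx]
    ring
  · convert! seriesEq_B1 hc using 1
    rw [genInt_one_eq hx]
    field_simp
    ring
  · convert! seriesEq_B2 hc using 1
    rw [genInt_wlog_eq hx]
    field_simp
    ring
  · convert! seriesEq_B3 hc using 1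
    rw [genInt_well_eq hx]
    field_simp
    ring
  · convert! seriesEq_C1 hc using 1
    rw [hD', genInt_one_eq hx]
    field_simp
    ring
  · convert! seriesEq_C2 hc using 1
    rw [hD', hI, genInt_well_eq hx, genInt_one_eq hx, genInt_one_eq hx]
    generalize hd : 1 - 3 * x ^ 2 = d at hD ⊢
    field_simp
    rw [← hd]
    ring
  · convert! seriesEq_D1 hc using 1
    rw [genInt_one_eq hx]
    field_simp
    ring
  · convert! seriesEq_D2 hc using 1
    rw [genInt_wlog_eq hx]
    generalize hd : 1 - 3 * x ^ 2 = d at hD ⊢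
    field_simp
    rw [← hd]
    ring
  · convert! seriesEq_D3 hc using 1
    rw [genInt_well_eq hx]
    generalize hd : 1 - 3 * x ^ 2 = d at hD ⊢
    field_simp
    rw [← hd]
    ring
  · convert! seriesEq_D4 hc using 1
    rw [hI, genInt_wlog_eq hx, genInt_one_eq hx, genInt_one_eq hx]
    generalize hd : 1 - 3 * x ^ 2 = d at hD ⊢
    field_simp
    rw [← hd]
    ring
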